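/- **Setting.** Let $(\Omega,\mathcal A,P)$ be a probability space, $H$ a complex Hilbert space, $d\ge 0$ an integer (the case $d=0$, where $\mathbb R^0$ is a point, is allowed), and let $\mathcal H$ be the Hilbert space of all $f\in L^2(P;H)$ with $\int f\,dP=0$. The algebra $B(H)$ acts on $\mathcal H$ by $(af)(\omega)=a(f(\omega))$, and the Gramian of $f,g\in\mathcal H$ is the operator $[f,g]=\int f(\omega)\otimes\overline{g(\omega)}\,dP(\omega)$ on $H$, where $(h\otimes\bar k)h'=(h',k)h$. On $\mathbb R^d$ let $s\le t$ mean $s_j\le t_j$ for all $j$, and fix $0\le m\le\infty$. We consider the following mappings with values in $\mathcal H$. * A *continuous random field* is a continuous map $F:\mathbb R^d\to\mathcal H$. Its observable set up to the moment $t$ is $\{F(s): s\le t\}$. * A *stochastic measure* is a countably additive function $\xi$ from the bounded Borel subsets of $\mathbb R^d$ to $\mathcal H$ which has finite semivariation $\|\xi\|(A)=\sup\|\sum_i\alpha_i\xi(A_i)\|$ (the supremum over finite Borel partitions $(A_i)$ of $A$ and $\alpha_i\in\mathbb C$ with $|\alpha_i|\le1$) on every bounded Borel set $A$, and is regular: for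 every such $A$ and every $\varepsilon>0$ there are a compact $K$ and a bounded open $O$ with $K\subset A\subset O$ and $\|\xi\|(O\setminus K)<\varepsilon$. Its observable set up to $t$ is the set of all $\xi(A)$ with $A\subset\{s:s\le t\}$. * A *random distribution field of order $m$* is a continuous linear map $U:\mathcal D^m(\mathbb R^d)\to\mathcal H$, where $\mathcal D^m(\mathbb R^d)$ is the space of complex valued compactly supported $C^m$ functions. Its observable set up to $t$ is the set of all $U_\varphi$ with $\varphi$ of class $C^\infty$ and $\operatorname{supp}\varphi\subset\{s:s\le t\}$. For such a mapping $\Phi$, let $\mathcal H_\Phi$ (respectively $\mathcal H_{(\Phi)}$) be the closed $B(H)$-submodule (respectively closed linear subspace) of $\mathcal H$ generated by all values of $\Phi$, let $\mathcal H^t_\Phi$ (respectively $\mathcal H^t_{(\Phi)}$) be the one generated by the observable set up to $t$, and put $\mathcal H^{-\infty}_\Phi=\bigcap_{t}\mathcal H^t_\Phi$ and $\mathcal H^{-\infty}_{(\Phi)}=\bigcap_t\mathcal H^t_{(\Phi)}$. The mapping $\Phi$ is *operator deterministic* if $\mathcal H^{-\infty}_\Phi=\mathcal H_\Phi$, *operator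 nondeterministic* if $\mathcal H^{-\infty}_\Phi\subsetneq\mathcal H_\Phi$, and *operator purely nondeterministic* if $\mathcal H^{-\infty}_\Phi=\{0\}$; it is *deterministic*, *nondeterministic* or *purely nondeterministic* if the same holds for $\mathcal H^{-\infty}_{(\Phi)}$ and $\mathcal H_{(\Phi)}$. Let $P_\Phi$ be the orthogonal projection of $\mathcal H$ onto the closed submodule $\mathcal H^{-\infty}_\Phi$. The *Wold summands* of $\Phi$ are $\Phi^{det}=P_\Phi\Phi$ and $\Phi^p=(I-P_\Phi)\Phi$. For a continuous random field $F$ let $\xi^F(A)=\int_AF(t)\,dt$ and $U^F_\varphi=\int\varphi(t)F(t)\,dt$; for a stochastic measure $\xi$ let $U^\xi_\varphi=\int\varphi\,d\xi$. Then $\xi^F$ is a stochastic measure, and $U^F$ and $U^\xi$ are random distribution fields of order $m$. **Corollary 5.5 (coherence of Wold decompositions).** Let $F$ be a continuous random field and let $\xi$ be a stochastic measure. 1. If one of $F$, $\xi^F$, $U^F$ is deterministic, then so are the other two. The same is true with each of "nondeterministic", "purely nondeterministic", "operator deterministic", "operator nondeterministic" and "operator purely nondeterministic" in place of "deterministic".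 All six equivalences also hold between $\xi$ and $U^\xi$. 2. For $\Phi$ any one of $F,\xi^F,U^F,\xi,U^\xi$, the Wold summands are mappings of the same kind as $\Phi$ and form a Wold decomposition of $\Phi$: $\Phi=\Phi^{det}+\Phi^p$, $\Phi^{det}$ is operator deterministic, $\Phi^p$ is operator purely nondeterministic, $\mathcal H_{\Phi^{det}}\subset\mathcal H_\Phi$ and $\mathcal H_{\Phi^p}\subset\mathcal H_\Phi$, and $[\Phi^{det}(\lambda),\Phi^p(\mu)]=0$ for all indices $\lambda,\mu$. 3. The Wold summands correspond: $$(\xi^F)^{det}=\xi^{F^{det}},\quad(\xi^F)^p=\xi^{F^p},\quad (U^F)^{det}=U^{F^{det}},\quad (U^F)^p=U^{F^p},\quad (U^\xi)^{det}=U^{\xi^{det}},\quad (U^\xi)^p=U^{\xi^p}.$$ -/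

import Mathlib

open MeasureTheory Set Filter Topology
open scoped Distributions ENNReal

namespace WoldCoherence

noncomputable section

set_option linter.unusedSectionVars false

/-- The parameter space `ℝ^d`, with its coordinatewise order and Lebesgue measure. -/
abbrev Time (d : ℕ) : Type := Fin d → ℝ

/-! ### Second order `H`-valued random variables of zero mean -/

section RandomVariables

variable {Ω : Type*} [MeasurableSpace Ω] (P : Measure Ω) [IsProbabilityMeasure P]
  (H : Type*) [NormedAddCommGroup H] [InnerProductSpace ℂ H] [CompleteSpace H]

/-- The subspace of `L²(P; H)` of the elements of zero mean. -/
def meanZero : Submodule ℂ (Lp H 2 P) where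
  carrier := {f | ∫ ω, f ω ∂P = 0}
  add_mem' := by
    intro f g hf hg
    have hfi : Integrable f P := (Lp.memLp f).integrable (by norm_num)
    have hgi : Integrable g P := (Lp.memLp g).integrable (by norm_num)
    simp only [mem_ofPred_eq] at hf hg ⊢
    rw [integral_congr_ae (Lp.coeFn_add f g)]
    simp only [Pi.add_apply]
    rw [integral_add hfi hgi, hf, hg, add_zero]
  zero_mem' := by
    simp only [mem_ofPred_eq]
    rw [integral_congr_ae (Lp.coeFn_zero H 2 P)]
    simp
  smul_mem' := by
    intro c f hf
    simp only [mem_ofPred_eq] at hf ⊢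
    rw [integral_congr_ae (Lp.coeFn_smul c f)]
    simp only [Pi.smul_apply]
    rw [integral_smul, hf, smul_zero]

/-- The space of multivariate (`H`-valued, strong) second order random variables of zero mean. -/
abbrev SecondOrder : Type _ := ↥(meanZero P H)

variable {P H}

theorem isClosed_meanZero : IsClosed (meanZero P H : Set (Lp H 2 P)) := by
  have hb : ∀ f : Lp H 2 P, ‖∫ ω, f ω ∂P‖ ≤ ‖f‖ := by
    intro f
    have h1 : eLpNorm f 1 P ≤ eLpNorm f 2 P :=
      eLpNorm_le_eLpNorm_of_exponent_le (by norm_num) (Lp.aestronglyMeasurable f)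
    refine (norm_integral_le_lintegral_norm _).trans ?_
    rw [Lp.norm_def]
    refine ENNReal.toReal_mono (Lp.eLpNorm_ne_top f) ?_
    refine le_trans (le_of_eq ?_) h1
    rw [eLpNorm_one_eq_lintegral_enorm]
    simp
  let L : Lp H 2 P →+ H :=
    { toFun := fun f => ∫ ω, f ω ∂P
      map_zero' := (meanZero P H).zero_mem
      map_add' := by
        intro f g
        have hfi : Integrable f P := (Lp.memLp f).integrable (by norm_num)
        have hgi : Integrable g P := (Lp.memLp g).integrable (by norm_num)
        rw [integral_congr_ae (Lp.coeFn_add f g)]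
        simp only [Pi.add_apply]
        exact integral_add hfi hgi }
  have hL : Continuous L :=
    AddMonoidHomClass.continuous_of_bound L 1 (fun f => by rw [one_mul]; exact hb f)
  exact isClosed_singleton.preimage (f := L) (t := {0}) hL

instance instCompleteSpaceSecondOrder : CompleteSpace (SecondOrder P H) :=
  isClosed_meanZero.completeSpace_coe

/-- The action of `a ∈ B(H)` on second order random variables, `(a f)(ω) = a (f ω)`. -/
def act (a : H →L[ℂ] H) : SecondOrder P H →L[ℂ] SecondOrder P H :=
  ((a.compLpL 2 P).comp (meanZero P H).subtypeL).codRestrict (meanZero P H) (by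
    intro f
    have hfi : Integrable (f : Lp H 2 P) P := (Lp.memLp _).integrable (by norm_num)
    have hf : ∫ ω, (f : Lp H 2 P) ω ∂P = 0 := f.2
    change ∫ ω, (a.compLpL 2 P (f : Lp H 2 P)) ω ∂P = 0
    rw [integral_congr_ae (a.coeFn_compLpL (f : Lp H 2 P)), a.integral_comp_comm hfi, hf, map_zero])

/-- The Gramian `[f, g] = ∫ f(ω) ⊗ conj (g(ω)) dP(ω)`, where `h ⊗ conj k` is the rank one operator
`h' ↦ (h', k) h`. -/
def gramian (f g : SecondOrder P H) : H →L[ℂ] H :=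
  ∫ ω, InnerProductSpace.rankOne ℂ ((f : Lp H 2 P) ω) ((g : Lp H 2 P) ω) ∂P

/-- The closed linear subspace generated by a set of second order random variables. -/
def closedSpace (S : Set (SecondOrder P H)) : Submodule ℂ (SecondOrder P H) :=
  (Submodule.span ℂ S).topologicalClosure

/-- The closed `B(H)`-submodule generated by a set of second order random variables: the closure of
the set of the finite sums `∑ aᵢ xᵢ` with `aᵢ ∈ B(H)` and `xᵢ ∈ S`. -/
def closedModule (S : Set (SecondOrder P H)) : Submodule ℂ (SecondOrder P H) :=
  (Submodule.span ℂ {y | ∃ a : H →L[ℂ] H, ∃ x ∈ S, y = act a x}).topologicalClosure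

/-! ### Stochastic mappings, their domains, and (non)determinism

A stochastic mapping is a function `Φ : Λ → SecondOrder P H`. Its observable structures depend on
the family `past : Time d → Set Λ` of the sets of indices that lie in the past of a given moment. -/

variable {Λ : Type*} {d : ℕ}

/-- The modular domain of a stochastic mapping. -/
def modularDomain (Φ : Λ → SecondOrder P H) : Submodule ℂ (SecondOrder P H) :=
  closedModule (range Φ)

/-- The vector domain of a stochastic mapping. -/
def vectorDomain (Φ : Λ → SecondOrder P H) : Submodule ℂ (SecondOrder P H) :=
  closedSpace (range Φ)

/-- The observable module up to the moment `t`. -/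
def observableModule (past : Time d → Set Λ) (Φ : Λ → SecondOrder P H) (t : Time d) :
    Submodule ℂ (SecondOrder P H) :=
  closedModule (Φ '' past t)

/-- The observable space up to the moment `t`. -/
def observableSpace (past : Time d → Set Λ) (Φ : Λ → SecondOrder P H) (t : Time d) :
    Submodule ℂ (SecondOrder P H) :=
  closedSpace (Φ '' past t)

/-- The remote past module. -/
def remoteModule (past : Time d → Set Λ) (Φ : Λ → SecondOrder P H) :
    Submodule ℂ (SecondOrder P H) :=
  ⨅ t, observableModule past Φ t

/-- The remote past space. -/
def remoteSpace (past : Time d → Set Λ) (Φ : Λ → SecondOrder P H) :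
    Submodule ℂ (SecondOrder P H) :=
  ⨅ t, observableSpace past Φ t

def IsOperatorDeterministic (past : Time d → Set Λ) (Φ : Λ → SecondOrder P H) : Prop :=
  modularDomain Φ = remoteModule past Φ

def IsOperatorNondeterministic (past : Time d → Set Λ) (Φ : Λ → SecondOrder P H) : Prop :=
  remoteModule past Φ < modularDomain Φ

def IsOperatorPurelyNondeterministic (past : Time d → Set Λ) (Φ : Λ → SecondOrder P H) : Prop :=
  remoteModule past Φ = ⊥

def IsDeterministic (past : Time d → Set Λ) (Φ : Λ → SecondOrder P H) : Prop :=
  vectorDomain Φ = remoteSpace past Φ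

def IsNondeterministic (past : Time d → Set Λ) (Φ : Λ → SecondOrder P H) : Prop :=
  remoteSpace past Φ < vectorDomain Φ

def IsPurelyNondeterministic (past : Time d → Set Λ) (Φ : Λ → SecondOrder P H) : Prop :=
  remoteSpace past Φ = ⊥

/-- Two stochastic mappings, possibly with different index sets, are simultaneously (operator)
deterministic, (operator) nondeterministic or (operator) purely nondeterministic. -/
structure SameDeterminism {Λ' : Type*} (past : Time d → Set Λ) (Φ : Λ → SecondOrder P H)
    (past' : Time d → Set Λ') (Ψ : Λ' → SecondOrder P H) : Prop where
  opDet : IsOperatorDeterministic past Φ ↔ IsOperatorDeterministic past' Ψ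
  opNondet : IsOperatorNondeterministic past Φ ↔ IsOperatorNondeterministic past' Ψ
  opPurelyNondet :
    IsOperatorPurelyNondeterministic past Φ ↔ IsOperatorPurelyNondeterministic past' Ψ
  det : IsDeterministic past Φ ↔ IsDeterministic past' Ψ
  nondet : IsNondeterministic past Φ ↔ IsNondeterministic past' Ψ
  purelyNondet : IsPurelyNondeterministic past Φ ↔ IsPurelyNondeterministic past' Ψ

theorem isClosed_remoteModule (past : Time d → Set Λ) (Φ : Λ → SecondOrder P H) :
    IsClosed (remoteModule past Φ : Set (SecondOrder P H)) := by
  simp only [remoteModule, Submodule.coe_iInf]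
  exact isClosed_iInter fun t => Submodule.isClosed_topologicalClosure _

instance instHasOrthogonalProjectionRemoteModule (past : Time d → Set Λ)
    (Φ : Λ → SecondOrder P H) : (remoteModule past Φ).HasOrthogonalProjection :=
  haveI : CompleteSpace (remoteModule past Φ) := (isClosed_remoteModule past Φ).completeSpace_coe
  Submodule.HasOrthogonalProjection.ofCompleteSpace _

/-- The Gramian projection onto the remote past module. For a closed `B(H)`-submodule, Gramian
orthogonality and orthogonality coincide, so that it is the orthogonal projection. -/
def remoteProj (past : Time d → Set Λ) (Φ : Λ → SecondOrder P H) :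
    SecondOrder P H →L[ℂ] SecondOrder P H :=
  (remoteModule past Φ).starProjection

/-- `Φ = D + N` is a Wold decomposition: `D` is operator deterministic, `N` is operator purely
nondeterministic, both are operator subordinate to `Φ`, and they are operator uncorrelated. -/
structure IsWoldDecomposition (past : Time d → Set Λ) (Φ D N : Λ → SecondOrder P H) : Prop where
  eq_add : ∀ l, Φ l = D l + N l
  det : IsOperatorDeterministic past D
  purelyNondet : IsOperatorPurelyNondeterministic past N
  subordinate_det : modularDomain D ≤ modularDomain Φ
  subordinate_purelyNondet : modularDomain N ≤ modularDomain Φ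
  uncorrelated : ∀ l m, gramian (D l) (N m) = 0

end RandomVariables

/-! ### Stochastic measures -/

/-- The `δ`-ring of the bounded Borel subsets of `ℝ^d`. -/
abbrev BoundedBorel (d : ℕ) : Type :=
  {A : Set (Time d) // MeasurableSet A ∧ Bornology.IsBounded A}

section Measures

variable {d : ℕ} {X : Type*} [NormedAddCommGroup X] [NormedSpace ℂ X]

/-- The semivariation `‖ξ‖(A) = sup ‖∑ αᵢ ξ(Aᵢ)‖`, where the supremum is taken over the finite
partitions `(Aᵢ)` of `A` and over the `αᵢ ∈ ℂ` with `|αᵢ| ≤ 1`. -/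
def semivariation (ξ : BoundedBorel d → X) (A : Set (Time d)) : ℝ≥0∞ :=
  ⨆ (m : ℕ) (B : Fin m → BoundedBorel d) (_ : Pairwise fun i j => Disjoint (B i : Set (Time d)) (B j))
    (_ : ⋃ i, (B i : Set (Time d)) = A) (α : Fin m → ℂ) (_ : ∀ i, ‖α i‖ ≤ 1),
    ‖∑ i, α i • ξ (B i)‖ₑ

variable (d X) in
/-- Regular, not necessarily bounded, `X`-valued measures on `ℝ^d` of finite semivariation: the
countably additive regular functions on the bounded Borel sets whose semivariation is finite. -/
structure VecMeasure where
  toFun : BoundedBorel d → X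
  hasSum_iUnion : ∀ (A : ℕ → BoundedBorel d) (B : BoundedBorel d),
    (Pairwise fun i j => Disjoint (A i : Set (Time d)) (A j)) →
    ⋃ i, (A i : Set (Time d)) = B → HasSum (fun i => toFun (A i)) (toFun B)
  semivariation_lt_top : ∀ A : BoundedBorel d, semivariation toFun A < ∞
  regular : ∀ (A : BoundedBorel d) (ε : ℝ≥0∞), 0 < ε → ∃ K O : BoundedBorel d,
    IsCompact (K : Set (Time d)) ∧ IsOpen (O : Set (Time d)) ∧ (K : Set (Time d)) ⊆ A ∧
    (A : Set (Time d)) ⊆ O ∧ semivariation toFun ((O : Set (Time d)) \ K) < ε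

theorem semivariation_map_le {Y : Type*} [NormedAddCommGroup Y] [NormedSpace ℂ Y]
    (T : X →L[ℂ] Y) (ξ : BoundedBorel d → X) (A : Set (Time d)) :
    semivariation (fun B => T (ξ B)) A ≤ ‖T‖ₑ * semivariation ξ A := by
  refine iSup_le fun m => iSup_le fun B => iSup_le fun hB => iSup_le fun hA => iSup_le fun α =>
    iSup_le fun hα => ?_
  have h1 : ∑ i, α i • T (ξ (B i)) = T (∑ i, α i • ξ (B i)) := by simp [map_sum]
  rw [h1]
  refine (T.le_opENorm _).trans ?_
  gcongr
  exact le_iSup_of_le m (le_iSup_of_le B (le_iSup_of_le hB (le_iSup_of_le hA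
    (le_iSup_of_le α (le_iSup_of_le hα le_rfl)))))

namespace VecMeasure

instance : CoeFun (VecMeasure d X) (fun _ => BoundedBorel d → X) := ⟨VecMeasure.toFun⟩

/-- The image `A ↦ T (ξ A)` of a measure under a bounded linear operator. -/
def map (T : X →L[ℂ] X) (ξ : VecMeasure d X) : VecMeasure d X where
  toFun A := T (ξ A)
  hasSum_iUnion A B hA hB := (ξ.hasSum_iUnion A B hA hB).mapL T
  semivariation_lt_top A :=
    (semivariation_map_le T ξ.toFun A).trans_lt
      (ENNReal.mul_lt_top enorm_lt_top (ξ.semivariation_lt_top A))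
  regular A ε hε := by
    have hT : ‖T‖ₑ + 1 ≠ ∞ := by simp
    have hT0 : ‖T‖ₑ + 1 ≠ 0 := by simp
    obtain ⟨K, O, hK, hO, hKA, hAO, h⟩ :=
      ξ.regular A (ε / (‖T‖ₑ + 1)) (ENNReal.div_pos hε.ne' hT)
    refine ⟨K, O, hK, hO, hKA, hAO, ?_⟩
    calc semivariation (fun A => T (ξ A)) ((O : Set (Time d)) \ K)
        ≤ ‖T‖ₑ * semivariation ξ.toFun ((O : Set (Time d)) \ K) := semivariation_map_le T _ _
      _ ≤ (‖T‖ₑ + 1) * semivariation ξ.toFun ((O : Set (Time d)) \ K) := by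
          gcongr; exact le_self_add
      _ < (‖T‖ₑ + 1) * (ε / (‖T‖ₑ + 1)) := ENNReal.mul_lt_mul_right hT0 hT h
      _ = ε := ENNReal.mul_div_cancel hT0 hT

end VecMeasure

/-! ### The measure of a continuous random field -/

theorem isBounded_exists_bound (F : C(Time d, X)) {A : Set (Time d)} (hA : Bornology.IsBounded A) :
    ∃ M : ℝ, 0 ≤ M ∧ ∀ t ∈ A, ‖F t‖ ≤ M := by
  obtain ⟨M, hM⟩ := hA.isCompact_closure.exists_bound_of_continuousOn F.continuous.continuousOn
  exact ⟨max M 0, le_max_right _ _, fun t ht => (hM t (subset_closure ht)).trans (le_max_left _ _)⟩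

theorem integrableOn_of_isBounded (F : C(Time d, X)) {A : Set (Time d)}
    (hA : Bornology.IsBounded A) : IntegrableOn F A volume :=
  (F.continuous.continuousOn.integrableOn_compact hA.isCompact_closure).mono_set subset_closure

theorem semivariation_setIntegral_le (F : C(Time d, X)) {A : Set (Time d)} {M : ℝ}
    (hM : 0 ≤ M) (h : ∀ t ∈ A, ‖F t‖ ≤ M) :
    semivariation (fun B : BoundedBorel d => ∫ t in (B : Set (Time d)), F t) A ≤
      ENNReal.ofReal M * volume A := by
  refine iSup_le fun m => iSup_le fun B => iSup_le fun hB => iSup_le fun hA => iSup_le fun α =>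
    iSup_le fun hα => ?_
  have hvol : ∀ i, volume (B i : Set (Time d)) < ∞ := fun i => (B i).2.2.measure_lt_top
  have h1 : ∀ i, ‖α i • ∫ t in (B i : Set (Time d)), F t‖ₑ ≤
      ENNReal.ofReal M * volume (B i : Set (Time d)) := by
    intro i
    have hsub : (B i : Set (Time d)) ⊆ A := hA ▸ subset_iUnion (fun i => (B i : Set (Time d))) i
    have h2 : ‖∫ t in (B i : Set (Time d)), F t‖ ≤ M * volume.real (B i : Set (Time d)) :=
      norm_setIntegral_le_of_norm_le_const (hvol i) (fun t ht => h t (hsub ht))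
    have h3 : ‖α i • ∫ t in (B i : Set (Time d)), F t‖ ≤ M * volume.real (B i : Set (Time d)) := by
      rw [norm_smul]
      calc ‖α i‖ * _ ≤ 1 * ‖∫ t in (B i : Set (Time d)), F t‖ := by gcongr; exact hα i
        _ ≤ _ := by rw [one_mul]; exact h2
    rw [← ofReal_norm]
    refine (ENNReal.ofReal_le_ofReal h3).trans ?_
    rw [ENNReal.ofReal_mul hM, measureReal_def, ENNReal.ofReal_toReal (hvol i).ne]
  calc ‖∑ i, α i • ∫ t in (B i : Set (Time d)), F t‖ₑ
      ≤ ∑ i, ‖α i • ∫ t in (B i : Set (Time d)), F t‖ₑ := enorm_sum_le _ _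
    _ ≤ ∑ i, ENNReal.ofReal M * volume (B i : Set (Time d)) := Finset.sum_le_sum fun i _ => h1 i
    _ = ENNReal.ofReal M * volume A := by
        rw [← Finset.mul_sum, ← hA, measure_iUnion hB (fun i => (B i).2.1), tsum_fintype]

/-- The regular measure `ξ^F(A) = ∫_A F(t) dt` of a continuous random field `F`. -/
def fieldMeasure (F : C(Time d, X)) : VecMeasure d X where
  toFun A := ∫ t in (A : Set (Time d)), F t
  hasSum_iUnion A B hA hB := by
    simp only [← hB]
    exact hasSum_integral_iUnion (fun i => (A i).2.1) hA
      (hB ▸ integrableOn_of_isBounded F B.2.2)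
  semivariation_lt_top A := by
    obtain ⟨M, hM0, hM⟩ := isBounded_exists_bound F A.2.2
    exact (semivariation_setIntegral_le F hM0 hM).trans_lt
      (ENNReal.mul_lt_top ENNReal.ofReal_lt_top A.2.2.measure_lt_top)
  regular A ε hε := by
    obtain ⟨R, hR⟩ := A.2.2.subset_ball 0
    obtain ⟨M, hM0, hM⟩ := isBounded_exists_bound F (Metric.isBounded_ball (x := (0 : Time d)) (r := R))
    have hM1 : ENNReal.ofReal M + 1 ≠ ∞ := by simp
    have hM10 : ENNReal.ofReal M + 1 ≠ 0 := by simp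
    set δ := ε / (ENNReal.ofReal M + 1) with hδ
    have hδ0 : δ ≠ 0 := (ENNReal.div_pos hε.ne' hM1).ne'
    have hδ2 : δ / 2 ≠ 0 := by simpa using hδ0
    have hAfin : volume (A : Set (Time d)) ≠ ∞ := A.2.2.measure_lt_top.ne
    obtain ⟨K, hKA, hK, hKv⟩ := A.2.1.exists_isCompact_sdiff_lt hAfin hδ2
    obtain ⟨O, hAO, hO, -, hOv⟩ := A.2.1.exists_isOpen_sdiff_lt hAfin hδ2
    refine ⟨⟨K, hK.measurableSet, hK.isBounded⟩,
      ⟨O ∩ Metric.ball 0 R, (hO.inter Metric.isOpen_ball).measurableSet,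
        Metric.isBounded_ball.subset inter_subset_right⟩, hK, hO.inter Metric.isOpen_ball, hKA,
        subset_inter hAO hR, ?_⟩
    have hv : volume ((O ∩ Metric.ball 0 R) \ K) < δ := by
      have : (O ∩ Metric.ball 0 R) \ K ⊆ (O \ A) ∪ ((A : Set (Time d)) \ K) := by
        intro x hx
        by_cases hxA : x ∈ (A : Set (Time d))
        · exact Or.inr ⟨hxA, hx.2⟩
        · exact Or.inl ⟨hx.1.1, hxA⟩
      calc volume ((O ∩ Metric.ball 0 R) \ K) ≤ volume (O \ A) + volume ((A : Set (Time d)) \ K) :=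
            (measure_mono this).trans (measure_union_le _ _)
        _ < δ / 2 + δ / 2 := ENNReal.add_lt_add hOv hKv
        _ = δ := ENNReal.add_halves δ
    calc _ ≤ ENNReal.ofReal M * volume ((O ∩ Metric.ball 0 R) \ K) :=
          semivariation_setIntegral_le F hM0 (fun t ht => hM t ht.1.2)
      _ ≤ (ENNReal.ofReal M + 1) * volume ((O ∩ Metric.ball 0 R) \ K) := by
          gcongr; exact le_self_add
      _ < (ENNReal.ofReal M + 1) * δ := ENNReal.mul_lt_mul_right hM10 hM1 hv
      _ = ε := ENNReal.mul_div_cancel hM10 hM1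

/-! ### Integration against a measure of finite semivariation -/

namespace VecMeasure

/-- The values of `ξ`, extended by `0` to the sets which are not bounded Borel sets. -/
def ext (ξ : VecMeasure d X) (A : Set (Time d)) : X :=
  open scoped Classical in
  if h : MeasurableSet A ∧ Bornology.IsBounded A then ξ ⟨A, h⟩ else 0

/-- The integral `∑ z • ξ {s = z}` of a simple function `s`. It is meant for simple functions
vanishing outside of a bounded set, for which `{s = z}` is a bounded Borel set when `z ≠ 0`. -/
def simpleIntegral (ξ : VecMeasure d X) (s : SimpleFunc (Time d) ℂ) : X :=
  ∑ z ∈ s.range, z • ξ.ext (s ⁻¹' {z})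

/-- `y` is the integral `∫ φ dξ`: there are simple functions, vanishing outside of a common
bounded set, which converge uniformly to `φ` and whose integrals converge to `y`. -/
def HasIntegral (ξ : VecMeasure d X) (φ : Time d → ℂ) (y : X) : Prop :=
  ∃ (B : BoundedBorel d) (s : ℕ → SimpleFunc (Time d) ℂ),
    (∀ k, ∀ t ∉ (B : Set (Time d)), s k t = 0) ∧
    TendstoUniformly (fun k t => s k t) φ atTop ∧
    Tendsto (fun k => ξ.simpleIntegral (s k)) atTop (𝓝 y)

/-- The integral `∫ φ dξ`, with value `0` if it does not exist. -/
def integral (ξ : VecMeasure d X) (φ : Time d → ℂ) : X :=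
  open scoped Classical in
  if h : ∃ y, ξ.HasIntegral φ y then h.choose else 0

variable (ξ : VecMeasure d X)

theorem ext_coe (A : BoundedBorel d) : ξ.ext A = ξ A := by
  simp [ext, A.2]

theorem apply_empty (E : BoundedBorel d) (hE : (E : Set (Time d)) = ∅) : ξ E = 0 := by
  have h := ξ.hasSum_iUnion (fun _ => E) E (fun i j _ => by simp [hE]) (by simp [hE])
  have h2 := h.summable.tendsto_atTop_zero
  exact tendsto_nhds_unique tendsto_const_nhds h2

theorem apply_union (A B C : BoundedBorel d) (hd : Disjoint (A : Set (Time d)) B)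
    (hC : (C : Set (Time d)) = (A : Set (Time d)) ∪ (B : Set (Time d))) : ξ C = ξ A + ξ B := by
  let E : BoundedBorel d := ⟨∅, MeasurableSet.empty, Bornology.isBounded_empty⟩
  let S : ℕ → BoundedBorel d := fun i => if i = 0 then A else if i = 1 then B else E
  have h := ξ.hasSum_iUnion S C (by
    intro i j hij
    rcases i with _ | _ | i <;> rcases j with _ | _ | j <;> simp_all [S, E, hd.symm]) (by
    rw [hC]
    ext x
    simp only [mem_iUnion, mem_union]
    constructor
    · rintro ⟨i, hi⟩
      rcases i with _ | _ | i <;> simp_all [S, E]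
    · rintro (hx | hx)
      · exact ⟨0, hx⟩
      · exact ⟨1, hx⟩)
  have h2 : HasSum (fun i => ξ (S i)) (∑ i ∈ Finset.range 2, ξ (S i)) := by
    apply hasSum_sum_of_ne_finset_zero
    intro i hi
    rcases i with _ | _ | i
    · simp at hi
    · simp at hi
    · exact ξ.apply_empty _ rfl
  rw [h.unique h2, Finset.sum_range_succ, Finset.sum_range_one]
  rfl

/-- The set function `A ↦ (z ↦ z • ξ (A ∩ B))`. -/
def op (B : BoundedBorel d) (A : Set (Time d)) : ℂ →L[ℝ] X :=
  (ContinuousLinearMap.toSpanSingleton ℂ (ξ.ext (A ∩ B))).restrictScalars ℝ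

theorem op_apply (B : BoundedBorel d) (A : Set (Time d)) (z : ℂ) :
    ξ.op B A z = z • ξ.ext (A ∩ B) := by
  simp [op]

theorem op_finMeasAdditive (B : BoundedBorel d) :
    FinMeasAdditive (0 : Measure (Time d)) (ξ.op B) := by
  intro s t hs ht _ _ hst
  refine ContinuousLinearMap.ext fun z => ?_
  simp only [op_apply, add_apply]
  have hb : ∀ s : Set (Time d), Bornology.IsBounded (s ∩ B) :=
    fun s => B.2.2.subset inter_subset_right
  have h := ξ.apply_union ⟨s ∩ B, hs.inter B.2.1, hb s⟩ ⟨t ∩ B, ht.inter B.2.1, hb t⟩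
    ⟨(s ∪ t) ∩ B, (hs.union ht).inter B.2.1, hb _⟩
    (hst.mono inter_subset_left inter_subset_left) (union_inter_distrib_right _ _ _)
  simp only [← ext_coe] at h
  rw [← smul_add, ← h]

theorem simpleIntegral_eq (B : BoundedBorel d) (s : SimpleFunc (Time d) ℂ)
    (hs : ∀ t ∉ (B : Set (Time d)), s t = 0) :
    ξ.simpleIntegral s = s.setToSimpleFunc (ξ.op B) := by
  refine Finset.sum_congr rfl fun z _ => ?_
  rw [op_apply]
  by_cases hz : z = 0
  · simp [hz]
  · congr 2
    refine (inter_eq_left.2 fun t ht => ?_).symm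
    by_contra h
    exact hz (by rw [← hs t h]; exact ht.symm)

theorem integrable_zero (s : SimpleFunc (Time d) ℂ) : Integrable s (0 : Measure (Time d)) :=
  integrable_zero_measure

theorem simpleIntegral_add (B : BoundedBorel d) (s t : SimpleFunc (Time d) ℂ)
    (hs : ∀ x ∉ (B : Set (Time d)), s x = 0) (ht : ∀ x ∉ (B : Set (Time d)), t x = 0) :
    ξ.simpleIntegral (s + t) = ξ.simpleIntegral s + ξ.simpleIntegral t := by
  rw [ξ.simpleIntegral_eq B s hs, ξ.simpleIntegral_eq B t ht,
    ξ.simpleIntegral_eq B (s + t) (fun x hx => by simp [hs x hx, ht x hx])]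
  exact SimpleFunc.setToSimpleFunc_add _ (ξ.op_finMeasAdditive B) (integrable_zero s)
    (integrable_zero t)

theorem simpleIntegral_sub (B : BoundedBorel d) (s t : SimpleFunc (Time d) ℂ)
    (hs : ∀ x ∉ (B : Set (Time d)), s x = 0) (ht : ∀ x ∉ (B : Set (Time d)), t x = 0) :
    ξ.simpleIntegral (s - t) = ξ.simpleIntegral s - ξ.simpleIntegral t := by
  rw [ξ.simpleIntegral_eq B s hs, ξ.simpleIntegral_eq B t ht,
    ξ.simpleIntegral_eq B (s - t) (fun x hx => by simp [hs x hx, ht x hx])]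
  exact SimpleFunc.setToSimpleFunc_sub _ (ξ.op_finMeasAdditive B) (integrable_zero s)
    (integrable_zero t)

theorem simpleIntegral_smul (B : BoundedBorel d) (c : ℂ) (s : SimpleFunc (Time d) ℂ)
    (hs : ∀ x ∉ (B : Set (Time d)), s x = 0) :
    ξ.simpleIntegral (c • s) = c • ξ.simpleIntegral s := by
  rw [ξ.simpleIntegral_eq B s hs,
    ξ.simpleIntegral_eq B (c • s) (fun x hx => by simp [hs x hx])]
  exact SimpleFunc.setToSimpleFunc_smul _ (ξ.op_finMeasAdditive B)
    (fun c s x => by simp [op_apply, mul_smul]) c (integrable_zero s)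

theorem norm_simpleIntegral_le (B : BoundedBorel d) (s : SimpleFunc (Time d) ℂ)
    (hs : ∀ x ∉ (B : Set (Time d)), s x = 0) {C : ℝ} (hC : ∀ x, ‖s x‖ ≤ C) :
    ‖ξ.simpleIntegral s‖ ≤ C * (semivariation ξ.toFun B).toReal := by
  have hC0 : 0 ≤ C := (norm_nonneg _).trans (hC 0)
  have hfin := (ξ.semivariation_lt_top B).ne
  rw [ξ.simpleIntegral_eq B s hs, SimpleFunc.setToSimpleFunc]
  let e := s.range.equivFin
  let A : Fin s.range.card → BoundedBorel d := fun i =>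
    ⟨s ⁻¹' {((e.symm i : s.range) : ℂ)} ∩ B, (s.measurableSet_fiber _).inter B.2.1,
      B.2.2.subset inter_subset_right⟩
  let α : Fin s.range.card → ℂ := fun i => ((e.symm i : s.range) : ℂ) / C
  have hrange : ∀ z : s.range, ‖(z : ℂ)‖ ≤ C := by
    rintro ⟨z, hz⟩
    obtain ⟨x, rfl⟩ := SimpleFunc.mem_range.1 hz
    exact hC x
  have hsum : ∑ z ∈ s.range, ξ.op B (s ⁻¹' {z}) z = (C : ℂ) • ∑ i, α i • ξ (A i) := by
    rw [← Finset.sum_coe_sort, ← e.symm.sum_comp, Finset.smul_sum]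
    refine Finset.sum_congr rfl fun i _ => ?_
    rw [op_apply, smul_smul, ← ext_coe]
    by_cases h0 : C = 0
    · have : ((e.symm i : s.range) : ℂ) = 0 := norm_le_zero_iff.1 (h0 ▸ hrange _)
      simp [this, h0]
    · congr 1
      simp only [α]
      rw [mul_div_cancel₀]
      exact_mod_cast h0
  have hle : ‖∑ i, α i • ξ (A i)‖ₑ ≤ semivariation ξ.toFun B := by
    refine le_iSup_of_le _ (le_iSup_of_le A (le_iSup_of_le ?_ (le_iSup_of_le ?_
      (le_iSup_of_le α (le_iSup_of_le ?_ le_rfl)))))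
    · intro i j hij
      refine Disjoint.mono inter_subset_left inter_subset_left ?_
      refine Disjoint.preimage _ ?_
      rw [disjoint_singleton]
      intro h
      exact hij (e.symm.injective (Subtype.ext h))
    · ext x
      simp only [mem_iUnion]
      constructor
      · rintro ⟨i, hi⟩
        exact hi.2
      · intro hx
        refine ⟨e ⟨s x, SimpleFunc.mem_range_self s x⟩, ?_, hx⟩
        simp
    · intro i
      simp only [α, norm_div, Complex.norm_real, Real.norm_of_nonneg hC0]
      exact div_le_one_of_le₀ (hrange _) hC0
  rw [hsum, norm_smul, Complex.norm_real, Real.norm_of_nonneg hC0]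
  gcongr
  rw [← toReal_enorm]
  exact ENNReal.toReal_mono hfin hle

/-- The union of two bounded Borel sets. -/
def _root_.WoldCoherence.unionBB (B C : BoundedBorel d) : BoundedBorel d :=
  ⟨(B : Set (Time d)) ∪ C, B.2.1.union C.2.1, B.2.2.union C.2.2⟩

theorem HasIntegral.add {φ ψ : Time d → ℂ} {y z : X} (h : ξ.HasIntegral φ y)
    (h' : ξ.HasIntegral ψ z) : ξ.HasIntegral (φ + ψ) (y + z) := by
  obtain ⟨B, s, hs, hu, hl⟩ := h
  obtain ⟨B', s', hs', hu', hl'⟩ := h'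
  have h1 : ∀ k, ∀ t ∉ (unionBB B B' : Set (Time d)), s k t = 0 :=
    fun k t ht => hs k t (fun h => ht (Or.inl h))
  have h2 : ∀ k, ∀ t ∉ (unionBB B B' : Set (Time d)), s' k t = 0 :=
    fun k t ht => hs' k t (fun h => ht (Or.inr h))
  refine ⟨unionBB B B', fun k => s k + s' k, fun k t ht => ?_, hu.add hu', ?_⟩
  · simp [h1 k t ht, h2 k t ht]
  · simp only [ξ.simpleIntegral_add _ _ _ (h1 _) (h2 _)]
    exact hl.add hl'

theorem HasIntegral.smul {φ : Time d → ℂ} {y : X} (c : ℂ) (h : ξ.HasIntegral φ y) :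
    ξ.HasIntegral (c • φ) (c • y) := by
  obtain ⟨B, s, hs, hu, hl⟩ := h
  refine ⟨B, fun k => c • s k, fun k t ht => by simp [hs k t ht], ?_, ?_⟩
  · exact (uniformContinuous_const_smul c).comp_tendstoUniformly hu
  · simp only [ξ.simpleIntegral_smul B _ _ (hs _)]
    exact hl.const_smul c

theorem HasIntegral.unique {φ : Time d → ℂ} {y z : X} (h : ξ.HasIntegral φ y)
    (h' : ξ.HasIntegral φ z) : y = z := by
  obtain ⟨B, s, hs, hu, hl⟩ := h
  obtain ⟨B', s', hs', hu', hl'⟩ := h'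
  have h1 : ∀ k, ∀ t ∉ (unionBB B B' : Set (Time d)), s k t = 0 :=
    fun k t ht => hs k t (fun h => ht (Or.inl h))
  have h2 : ∀ k, ∀ t ∉ (unionBB B B' : Set (Time d)), s' k t = 0 :=
    fun k t ht => hs' k t (fun h => ht (Or.inr h))
  set V := (semivariation ξ.toFun (unionBB B B')).toReal with hV
  have hV0 : 0 ≤ V := ENNReal.toReal_nonneg
  have hdu : TendstoUniformly (fun k t => s k t - s' k t) (φ - φ) atTop := hu.sub hu'
  have hlim : Tendsto (fun k => ξ.simpleIntegral (s k) - ξ.simpleIntegral (s' k)) atTop (𝓝 0) := by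
    rw [Metric.tendsto_atTop]
    intro ε hε
    have hδ : 0 < ε / (V + 1) := by positivity
    obtain ⟨N, hN⟩ := eventually_atTop.1 (Metric.tendstoUniformly_iff.1 hdu _ hδ)
    refine ⟨N, fun k hk => ?_⟩
    rw [dist_zero_right, ← ξ.simpleIntegral_sub _ _ _ (h1 k) (h2 k)]
    have hb : ∀ x, ‖(s k - s' k) x‖ ≤ ε / (V + 1) := fun x => by
      have := hN k hk x
      simpa [dist_eq_norm, norm_neg, norm_sub_rev] using this.le
    have := ξ.norm_simpleIntegral_le (unionBB B B') (s k - s' k)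
      (fun x hx => by simp [h1 k x hx, h2 k x hx]) hb
    calc _ ≤ ε / (V + 1) * V := this
      _ < ε / (V + 1) * (V + 1) := by gcongr; linarith
      _ = ε := by field_simp
  exact sub_eq_zero.1 (tendsto_nhds_unique (hl.sub hl') hlim)

theorem integral_eq {φ : Time d → ℂ} {y : X} (h : ξ.HasIntegral φ y) : ξ.integral φ = y := by
  have h' : ∃ y, ξ.HasIntegral φ y := ⟨y, h⟩
  rw [integral, dif_pos h']
  exact HasIntegral.unique ξ h'.choose_spec h

theorem exists_approx {φ : Time d → ℂ} (hφ : Continuous φ) (B : BoundedBorel d)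
    (hB : IsCompact (B : Set (Time d))) (h0 : ∀ x ∉ (B : Set (Time d)), φ x = 0) {ε : ℝ}
    (hε : 0 < ε) : ∃ s : SimpleFunc (Time d) ℂ, (∀ x ∉ (B : Set (Time d)), s x = 0) ∧
      ∀ x, dist (φ x) (s x) < ε := by
  have hcs : HasCompactSupport φ := HasCompactSupport.intro hB h0
  have hcs' : HasCompactSupport (fun p : Time d × Unit => φ p.1) :=
    HasCompactSupport.intro (K := (B : Set (Time d)) ×ˢ univ) (hB.prod isCompact_univ)
      (fun p hp => h0 _ (fun h => hp ⟨h, mem_univ _⟩))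
  obtain ⟨g, hg⟩ := hcs'.exists_simpleFunc_approx_of_prod (hφ.comp continuous_fst) hε
  refine ⟨(g.comp (fun x => (x, ())) measurable_prodMk_right).restrict B, fun x hx => ?_,
    fun x => ?_⟩
  · rw [SimpleFunc.restrict_apply _ B.2.1, indicator_of_notMem hx]
  · rw [SimpleFunc.restrict_apply _ B.2.1]
    by_cases hx : x ∈ (B : Set (Time d))
    · rw [indicator_of_mem hx]
      exact hg (x, ())
    · rw [indicator_of_notMem hx, h0 x hx, dist_self]
      exact hε

variable [CompleteSpace X]

theorem hasIntegral_of_continuous {φ : Time d → ℂ} (hφ : Continuous φ) (B : BoundedBorel d)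
    (hB : IsCompact (B : Set (Time d))) (h0 : ∀ x ∉ (B : Set (Time d)), φ x = 0) :
    ξ.HasIntegral φ (ξ.integral φ) ∧ ∀ C : ℝ, (∀ x, ‖φ x‖ ≤ C) →
      ‖ξ.integral φ‖ ≤ C * (semivariation ξ.toFun B).toReal := by
  set V := (semivariation ξ.toFun B).toReal with hV
  have hV0 : 0 ≤ V := ENNReal.toReal_nonneg
  choose s hs0 hs using fun k : ℕ => exists_approx hφ B hB h0 (Nat.one_div_pos_of_nat (α := ℝ) (n := k))
  have hu : TendstoUniformly (fun k t => s k t) φ atTop := by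
    rw [Metric.tendstoUniformly_iff]
    intro ε hε
    obtain ⟨N, hN⟩ := exists_nat_one_div_lt hε
    filter_upwards [eventually_ge_atTop N] with k hk x
    refine (hs k x).trans (lt_of_le_of_lt ?_ hN)
    exact Nat.one_div_le_one_div hk
  have hcau : CauchySeq (fun k => ξ.simpleIntegral (s k)) := by
    refine cauchySeq_of_le_tendsto_0 (fun N : ℕ => (2 * (1 / ((N : ℝ) + 1))) * V) ?_ ?_
    · intro m k N hm hk
      rw [dist_eq_norm, ← ξ.simpleIntegral_sub B _ _ (hs0 m) (hs0 k)]
      refine ξ.norm_simpleIntegral_le B _ (fun x hx => by simp [hs0 m x hx, hs0 k x hx]) ?_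
      intro x
      have h1 : dist (s m x) (s k x) ≤ dist (φ x) (s m x) + dist (φ x) (s k x) :=
        dist_triangle_left _ _ _
      have h2 := hs m x
      have h3 := hs k x
      have h4 : 1 / ((m : ℝ) + 1) ≤ 1 / ((N : ℝ) + 1) := Nat.one_div_le_one_div hm
      have h5 : 1 / ((k : ℝ) + 1) ≤ 1 / ((N : ℝ) + 1) := Nat.one_div_le_one_div hk
      rw [SimpleFunc.coe_sub, Pi.sub_apply, ← dist_eq_norm]
      linarith
    · have := (tendsto_one_div_add_atTop_nhds_zero_nat (𝕜 := ℝ)).const_mul 2 |>.mul_const V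
      simpa using this
  obtain ⟨y, hy⟩ := cauchySeq_tendsto_of_complete hcau
  have hI : ξ.HasIntegral φ y := ⟨B, s, hs0, hu, hy⟩
  rw [ξ.integral_eq hI]
  refine ⟨hI, fun C hC => ?_⟩
  have hlim : Tendsto (fun k : ℕ => (C + 1 / ((k : ℝ) + 1)) * V) atTop (𝓝 (C * V)) := by
    have := ((tendsto_one_div_add_atTop_nhds_zero_nat (𝕜 := ℝ)).const_add C).mul_const V
    simpa using this
  refine le_of_tendsto_of_tendsto' hy.norm hlim fun k => ?_
  refine ξ.norm_simpleIntegral_le B _ (hs0 k) fun x => ?_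
  have h1 := hs k x
  have h2 := hC x
  have h3 : ‖s k x‖ ≤ ‖φ x‖ + dist (φ x) (s k x) := by
    rw [dist_comm, dist_eq_norm]
    have := norm_add_le (φ x) (s k x - φ x)
    simpa using this
  linarith

end VecMeasure

/-! ### The distributions of a random field and of a measure -/

section Distributions

variable [CompleteSpace X]

/-- The space `𝓓^n(ℝ^d)` of complex valued, compactly supported `C^n` functions on `ℝ^d`. -/
abbrev Test (d : ℕ) (n : ℕ∞) : Type := 𝓓^{n}((⊤ : TopologicalSpace.Opens (Time d)), ℂ)

/-- The distribution `U^F_φ = ∫ φ(t) F(t) dt` of a continuous random field `F`. -/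
def fieldDistribution (n : ℕ∞) (F : C(Time d, X)) : Test d n →L[ℂ] X :=
  TestFunction.integralAgainstBilinCLM (ContinuousLinearMap.lsmul ℂ ℂ) volume F

theorem fieldDistribution_apply (n : ℕ∞) (F : C(Time d, X)) (φ : Test d n) :
    fieldDistribution n F φ = ∫ t, φ t • F t :=
  TestFunction.integralAgainstBilinCLM_eq_integral
    (F.continuous.locallyIntegrable.locallyIntegrableOn _)

theorem VecMeasure.hasIntegral_test (ξ : VecMeasure d X) {n : ℕ∞} (φ : Test d n) :
    ξ.HasIntegral φ (ξ.integral φ) :=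
  (ξ.hasIntegral_of_continuous φ.continuous
    ⟨tsupport φ, (isClosed_tsupport _).measurableSet, φ.hasCompactSupport.isCompact.isBounded⟩
    φ.hasCompactSupport (fun _ hx => image_eq_zero_of_notMem_tsupport hx)).1

/-- The distribution `U^ξ_φ = ∫ φ dξ` of a regular measure `ξ` of finite semivariation. -/
def measureDistribution (n : ℕ∞) (ξ : VecMeasure d X) : Test d n →L[ℂ] X :=
  TestFunction.mkCLM ℂ (fun φ => ξ.integral φ)
    (fun φ ψ => ξ.integral_eq
      (VecMeasure.HasIntegral.add ξ (ξ.hasIntegral_test φ) (ξ.hasIntegral_test ψ)))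
    (fun c φ => ξ.integral_eq (VecMeasure.HasIntegral.smul ξ c (ξ.hasIntegral_test φ)))
    (by
      intro K hK
      let B : BoundedBorel d := ⟨K, K.isCompact.measurableSet, K.isCompact.isBounded⟩
      let L : ContDiffMapSupportedIn (Time d) ℂ n K →+ X := AddMonoidHom.mk'
        (fun φ => ξ.integral (TestFunction.ofSupportedIn hK φ)) (fun φ ψ => ξ.integral_eq
          (VecMeasure.HasIntegral.add ξ (ξ.hasIntegral_test (TestFunction.ofSupportedIn hK φ))
            (ξ.hasIntegral_test (TestFunction.ofSupportedIn hK ψ))))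
      change Continuous L
      refine continuous_of_continuousAt_zero L ?_
      rw [ContinuousAt, map_zero]
      have hJ := (ContDiffMapSupportedIn.toBoundedContinuousFunctionCLM ℂ
        (E := Time d) (F := ℂ) (n := n) (K := K)).continuous.norm.tendsto 0
      have hJ2 := hJ.mul_const (semivariation ξ.toFun B).toReal
      simp only [map_zero, norm_zero, zero_mul] at hJ2
      refine squeeze_zero_norm (fun φ => ?_) hJ2
      exact (ξ.hasIntegral_of_continuous φ.contDiff.continuous B K.isCompact
        (fun x hx => φ.zero_on_compl hx)).2 _
        (fun x => (ContDiffMapSupportedIn.toBoundedContinuousFunctionCLM ℂ φ).norm_coe_le_norm x))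

end Distributions

end Measures

/-! ### The pasts of the three index sets, and the Wold summands -/

/-- For fields: the moments `s ≤ t`. -/
def fieldPast (d : ℕ) (t : Time d) : Set (Time d) := Iic t

/-- For measures: the bounded Borel sets contained in `{s | s ≤ t}`. -/
def measurePast (d : ℕ) (t : Time d) : Set (BoundedBorel d) := {A | (A : Set (Time d)) ⊆ Iic t}

/-- For distributions: the smooth test functions with support in `{s | s ≤ t}`. -/
def testPast (d : ℕ) (n : ℕ∞) (t : Time d) : Set (Test d n) :=
  {φ | ContDiff ℝ (⊤ : ℕ∞) φ ∧ tsupport φ ⊆ Iic t}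

section Wold

variable {Ω : Type*} [MeasurableSpace Ω] {P : Measure Ω} [IsProbabilityMeasure P]
  {H : Type*} [NormedAddCommGroup H] [InnerProductSpace ℂ H] [CompleteSpace H] {d : ℕ}

/-- `F^det(t) = P F(t)`, where `P` is the Gramian projection onto the remote past module of `F`. -/
def fieldDet (F : C(Time d, SecondOrder P H)) : C(Time d, SecondOrder P H) :=
  (remoteProj (fieldPast d) F : C(SecondOrder P H, SecondOrder P H)).comp F

/-- `F^p = F - F^det`. -/
def fieldPnd (F : C(Time d, SecondOrder P H)) : C(Time d, SecondOrder P H) := F - fieldDet F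

/-- `ξ^det(A) = P ξ(A)`, where `P` is the Gramian projection onto the remote past module of `ξ`. -/
def measureDet (ξ : VecMeasure d (SecondOrder P H)) : VecMeasure d (SecondOrder P H) :=
  ξ.map (remoteProj (measurePast d) ξ)

/-- `ξ^p(A) = (I - P) ξ(A)`. -/
def measurePnd (ξ : VecMeasure d (SecondOrder P H)) : VecMeasure d (SecondOrder P H) :=
  ξ.map (ContinuousLinearMap.id ℂ _ - remoteProj (measurePast d) ξ)

/-- `U^det_φ = P U_φ`, where `P` is the Gramian projection onto the remote past module of `U`. -/
def distributionDet {n : ℕ∞} (U : Test d n →L[ℂ] SecondOrder P H) :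
    Test d n →L[ℂ] SecondOrder P H :=
  (remoteProj (testPast d n) U).comp U

/-- `U^p_φ = (I - P) U_φ`. -/
def distributionPnd {n : ℕ∞} (U : Test d n →L[ℂ] SecondOrder P H) :
    Test d n →L[ℂ] SecondOrder P H :=
  (ContinuousLinearMap.id ℂ _ - remoteProj (testPast d n) U).comp U

end Wold

end

end WoldCoherence

namespace WoldCoherence

set_option linter.unusedSectionVars false

section Modules

variable {Ω : Type*} [MeasurableSpace Ω] {P : Measure Ω} [IsProbabilityMeasure P]
  {H : Type*} [NormedAddCommGroup H] [InnerProductSpace ℂ H] [CompleteSpace H]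

/-! ### The action of `B(H)` and closed modules -/

/-! All six notions depend only on the two domains and the two remote pasts of a mapping, so
coherence reduces to showing that these four subspaces agree (`SameRemotePast`). By
`SameRemotePast.of_shift` it is enough that the values of each mapping up to a suitably shifted time
lie in the closed linear span of the values of the other one up to `t`: the intersection over all
`t` absorbs the shift, and containment in a closed span gives containment of the generated modules
as well.

For `F` and `ξ^F`: a set integral is a volume times an average, which lies in the closed span of the
values averaged; conversely `F s` is a limit of averages over small cubes with upper corner `s`. For
`ξ` and `U^ξ`: `∫ φ dξ` is a limit of integrals of simple functions living on the support of `φ`;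
conversely regularity makes `ξ A` a limit of integrals of smooth cut-off functions
(`VecMeasure.apply_mem_closure`). The identity `U^F = U^(ξ^F)` (`fieldDistribution_eq`) reduces the
remaining pair to these two.

The Wold decomposition is the same argument for all kinds of mappings
(`isWoldDecomposition_remoteProj`): the remote past module and its orthogonal complement are both
invariant under `B(H)`, so the projection commutes with the action. Since corresponding mappings
have the same remote past module, they have the same projection, and a bounded operator can be
pulled through the integrals; hence the summands correspond. -/

theorem coeFn_act (a : H →L[ℂ] H) (f : SecondOrder P H) :
    ∀ᵐ ω ∂P, (act a f : Lp H 2 P) ω = a ((f : Lp H 2 P) ω) :=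
  a.coeFn_compLpL (f : Lp H 2 P)

theorem act_comp (a b : H →L[ℂ] H) (f : SecondOrder P H) :
    act (a.comp b) f = act a (act b f) := by
  refine Subtype.ext (Lp.ext ?_)
  filter_upwards [coeFn_act (a.comp b) f, coeFn_act a (act b f), coeFn_act b f] with ω h1 h2 h3
  rw [h1, h2, h3, ContinuousLinearMap.comp_apply]

theorem act_id (f : SecondOrder P H) : act (ContinuousLinearMap.id ℂ H) f = f := by
  refine Subtype.ext (Lp.ext ?_)
  filter_upwards [coeFn_act (ContinuousLinearMap.id ℂ H) f] with ω h
  rw [h, ContinuousLinearMap.id_apply]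

/-- The adjoint acts pointwise under the integral. This is what makes orthogonal complements of
submodules submodules again. -/
theorem inner_act_right (a : H →L[ℂ] H) (f g : SecondOrder P H) :
    inner ℂ g (act a f) = inner ℂ (act (ContinuousLinearMap.adjoint a) g) f := by
  simp only [Submodule.coe_inner, L2.inner_def]
  refine integral_congr_ae ?_
  filter_upwards [coeFn_act a f, coeFn_act (ContinuousLinearMap.adjoint a) g] with ω h1 h2
  rw [h1, h2, ContinuousLinearMap.adjoint_inner_left]

/-- A subspace is a `B(H)`-submodule if it is invariant under the action. -/
def IsActInvariant (K : Submodule ℂ (SecondOrder P H)) : Prop :=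
  ∀ (a : H →L[ℂ] H), ∀ f ∈ K, act a f ∈ K

theorem IsActInvariant.orthogonal {K : Submodule ℂ (SecondOrder P H)} (hK : IsActInvariant K) :
    IsActInvariant Kᗮ := by
  intro a f hf
  rw [Submodule.mem_orthogonal] at hf ⊢
  intro g hg
  rw [inner_act_right]
  exact hf _ (hK _ g hg)

/-- Both `K` and `Kᗮ` are invariant, so the action respects the orthogonal decomposition of `f`. -/
theorem IsActInvariant.starProjection_act {K : Submodule ℂ (SecondOrder P H)}
    [K.HasOrthogonalProjection] (hK : IsActInvariant K) (a : H →L[ℂ] H) (f : SecondOrder P H) :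
    K.starProjection (act a f) = act a (K.starProjection f) := by
  refine Submodule.eq_starProjection_of_mem_orthogonal
    (hK a _ (K.starProjection_apply_mem f)) ?_
  rw [← map_sub]
  exact hK.orthogonal a _ (K.sub_starProjection_mem_orthogonal f)

theorem isClosed_closedSpace (S : Set (SecondOrder P H)) :
    IsClosed (closedSpace S : Set (SecondOrder P H)) :=
  Submodule.isClosed_topologicalClosure _

theorem isClosed_closedModule (S : Set (SecondOrder P H)) :
    IsClosed (closedModule S : Set (SecondOrder P H)) :=
  Submodule.isClosed_topologicalClosure _

theorem isActInvariant_closedModule (S : Set (SecondOrder P H)) :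
    IsActInvariant (closedModule S) := by
  intro a
  have h : closedModule S ≤ (closedModule S).comap (act (P := P) a).toLinearMap := by
    refine Submodule.topologicalClosure_minimal _ (Submodule.span_le.2 ?_)
      ((isClosed_closedModule S).preimage (act a).continuous)
    rintro _ ⟨b, x, hx, rfl⟩
    refine Submodule.le_topologicalClosure _ (Submodule.subset_span ⟨a.comp b, x, hx, ?_⟩)
    exact (act_comp a b x).symm
  exact fun f hf => h hf

theorem subset_closedModule (S : Set (SecondOrder P H)) : S ⊆ closedModule S := fun x hx =>
  Submodule.le_topologicalClosure _ (Submodule.subset_span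
    ⟨ContinuousLinearMap.id ℂ H, x, hx, (act_id x).symm⟩)

theorem closedModule_le {S : Set (SecondOrder P H)} {K : Submodule ℂ (SecondOrder P H)}
    (hS : S ⊆ K) (hK : IsActInvariant K) (hc : IsClosed (K : Set (SecondOrder P H))) :
    closedModule S ≤ K := by
  refine Submodule.topologicalClosure_minimal _ (Submodule.span_le.2 ?_) hc
  rintro _ ⟨a, x, hx, rfl⟩
  exact hK a x (hS hx)

theorem closedSpace_le {S : Set (SecondOrder P H)} {K : Submodule ℂ (SecondOrder P H)}
    (hS : S ⊆ K) (hc : IsClosed (K : Set (SecondOrder P H))) : closedSpace S ≤ K :=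
  Submodule.topologicalClosure_minimal _ (Submodule.span_le.2 hS) hc

theorem closedSpace_le_closedModule (S : Set (SecondOrder P H)) :
    closedSpace S ≤ closedModule S :=
  closedSpace_le (subset_closedModule S) (isClosed_closedModule S)

theorem closedSpace_le_closedSpace {S T : Set (SecondOrder P H)} (h : S ⊆ closedSpace T) :
    closedSpace S ≤ closedSpace T :=
  closedSpace_le h (isClosed_closedSpace T)

/-- The hypothesis is deliberately the linear one, the same as in `closedSpace_le_closedSpace`: a
single approximation argument then serves the vector and the operator notions. -/
theorem closedModule_le_closedModule {S T : Set (SecondOrder P H)} (h : S ⊆ closedSpace T) :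
    closedModule S ≤ closedModule T :=
  closedModule_le (h.trans (closedSpace_le_closedModule T)) (isActInvariant_closedModule T)
    (isClosed_closedModule T)

/-! ### The Gramian -/

theorem continuous_rankOne {E : Type*} [NormedAddCommGroup E] [InnerProductSpace ℂ E] :
    Continuous fun p : E × E => InnerProductSpace.rankOne ℂ p.1 p.2 := by
  have h : Continuous fun p : E × E => innerSL ℂ p.2 := (innerSL ℂ).continuous.comp continuous_snd
  exact (ContinuousLinearMap.smulRightL ℂ E E).continuous₂.comp (h.prodMk continuous_fst)

theorem integrable_rankOne {f g : Ω → H} (hf : MemLp f 2 P) (hg : MemLp g 2 P) :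
    Integrable (fun ω => InnerProductSpace.rankOne ℂ (f ω) (g ω)) P := by
  have hm : AEStronglyMeasurable (fun ω => InnerProductSpace.rankOne ℂ (f ω) (g ω)) P :=
    Continuous.comp_aestronglyMeasurable (f := fun ω => (f ω, g ω))
      (g := fun p : H × H => InnerProductSpace.rankOne ℂ p.1 p.2) continuous_rankOne
      (hf.aestronglyMeasurable.prodMk hg.aestronglyMeasurable)
  have hi : Integrable (fun ω => ‖f ω‖ * ‖g ω‖) P := hf.norm.integrable_mul hg.norm
  refine hi.mono' hm (Eventually.of_forall fun ω => ?_)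
  rw [InnerProductSpace.norm_rankOne]

/-- The matrix coefficients of the Gramian are scalar products of `g` with elements of the module
generated by `f`. Orthogonality to a submodule therefore forces the Gramian to vanish. -/
theorem inner_gramian_apply (f g : SecondOrder P H) (h k : H) :
    inner ℂ h (gramian f g k) = inner ℂ g (act (InnerProductSpace.rankOne ℂ k h) f) := by
  have hi := integrable_rankOne (Lp.memLp (f : Lp H 2 P)) (Lp.memLp (g : Lp H 2 P))
  rw [gramian, ContinuousLinearMap.integral_apply hi, ← integral_inner (hi.apply_continuousLinearMap k),
    Submodule.coe_inner, L2.inner_def]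
  refine integral_congr_ae ?_
  filter_upwards [coeFn_act (InnerProductSpace.rankOne ℂ k h) f] with ω hω
  rw [hω, InnerProductSpace.rankOne_apply, InnerProductSpace.rankOne_apply, inner_smul_right,
    inner_smul_right, mul_comm]

theorem IsActInvariant.gramian_eq_zero {K : Submodule ℂ (SecondOrder P H)}
    (hK : IsActInvariant K) {f g : SecondOrder P H} (hf : f ∈ K) (hg : g ∈ Kᗮ) :
    gramian f g = 0 := by
  refine ContinuousLinearMap.ext fun k => ext_inner_left ℂ fun h => ?_
  rw [inner_gramian_apply, zero_apply, inner_zero_right]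
  exact Submodule.inner_left_of_mem_orthogonal (hK _ f hf) hg

/-! ### The Wold decomposition -/

variable {Λ : Type*} {d : ℕ}

theorem isActInvariant_remoteModule (past : Time d → Set Λ) (Φ : Λ → SecondOrder P H) :
    IsActInvariant (remoteModule past Φ) := by
  intro a f hf
  simp only [remoteModule, Submodule.mem_iInf] at hf ⊢
  exact fun t => isActInvariant_closedModule _ a f (hf t)

theorem remoteModule_le_observableModule (past : Time d → Set Λ) (Φ : Λ → SecondOrder P H)
    (t : Time d) : remoteModule past Φ ≤ observableModule past Φ t :=
  iInf_le _ t

theorem observableModule_le_modularDomain (past : Time d → Set Λ) (Φ : Λ → SecondOrder P H)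
    (t : Time d) : observableModule past Φ t ≤ modularDomain Φ :=
  closedModule_le ((image_subset_range _ _).trans (subset_closedModule _))
    (isActInvariant_closedModule _) (isClosed_closedModule _)

theorem remoteModule_le_modularDomain (past : Time d → Set Λ) (Φ : Λ → SecondOrder P H) :
    remoteModule past Φ ≤ modularDomain Φ :=
  (remoteModule_le_observableModule past Φ 0).trans (observableModule_le_modularDomain past Φ 0)

theorem remoteProj_mem (past : Time d → Set Λ) (Φ : Λ → SecondOrder P H) (f : SecondOrder P H) :
    remoteProj past Φ f ∈ remoteModule past Φ :=
  Submodule.starProjection_apply_mem _ f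

theorem sub_remoteProj_mem_orthogonal (past : Time d → Set Λ) (Φ : Λ → SecondOrder P H)
    (f : SecondOrder P H) : f - remoteProj past Φ f ∈ (remoteModule past Φ)ᗮ :=
  Submodule.sub_starProjection_mem_orthogonal f

/-- A closed submodule contained in the submodule generated by `S` is contained in the one
generated by the projections of the elements of `S`. -/
theorem IsActInvariant.le_closedModule_starProjection {K : Submodule ℂ (SecondOrder P H)}
    [K.HasOrthogonalProjection] (hK : IsActInvariant K) {S : Set (SecondOrder P H)}
    (hS : K ≤ closedModule S) : K ≤ closedModule (K.starProjection '' S) := by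
  -- The elements whose projection lies in the target form a closed invariant subspace containing
  -- `S`; elements of `K` are their own projections.
  have h : closedModule S ≤ (closedModule (K.starProjection '' S)).comap
      (K.starProjection : SecondOrder P H →ₗ[ℂ] SecondOrder P H) := by
    refine closedModule_le (fun x hx => subset_closedModule _ (mem_image_of_mem _ hx)) ?_
      ((isClosed_closedModule _).preimage K.starProjection.continuous)
    intro a f hf
    change K.starProjection (act a f) ∈ closedModule _
    rw [hK.starProjection_act]
    exact isActInvariant_closedModule _ a _ hf
  intro x hx
  rw [← Submodule.starProjection_eq_self_iff.2 hx]
  exact h (hS hx)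

/-- Nothing about the index set or the pasts is needed: `D` takes its values in the remote past
module and `N` in its orthogonal complement, and all the properties follow from the invariance of
these two. -/
theorem isWoldDecomposition_remoteProj (past : Time d → Set Λ) {Φ D N : Λ → SecondOrder P H}
    (hD : ∀ l, D l = remoteProj past Φ (Φ l)) (hN : ∀ l, N l = Φ l - D l) :
    IsWoldDecomposition past Φ D N := by
  have hinv := isActInvariant_remoteModule past Φ
  have hDmem : ∀ l, D l ∈ remoteModule past Φ := fun l => hD l ▸ remoteProj_mem past Φ _
  have hNmem : ∀ l, N l ∈ (remoteModule past Φ)ᗮ := fun l => by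
    rw [hN, hD]
    exact sub_remoteProj_mem_orthogonal past Φ _
  have hDle : modularDomain D ≤ remoteModule past Φ :=
    closedModule_le (range_subset_iff.2 hDmem) hinv (isClosed_remoteModule past Φ)
  refine ⟨fun l => by rw [hN, add_sub_cancel], ?_, ?_,
    hDle.trans (remoteModule_le_modularDomain past Φ), ?_,
    fun l m => hinv.gramian_eq_zero (hDmem l) (hNmem m)⟩
  -- The remote past module of `Φ` lies in every observable module of `Φ`; projecting the generators
  -- puts it into every observable module of `D`, while it contains the whole domain of `D`.
  · refine le_antisymm (hDle.trans (le_iInf fun t => ?_)) (remoteModule_le_modularDomain past D)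
    have h := hinv.le_closedModule_starProjection (remoteModule_le_observableModule past Φ t)
    rw [image_image] at h
    exact h.trans_eq (congrArg closedModule (image_congr fun l _ => (hD l).symm))
  -- An element of the remote past of `N` lies both in the remote past module of `Φ` and in its
  -- orthogonal complement.
  · refine (Submodule.eq_bot_iff _).2 fun x hx => ?_
    have hxt : ∀ t, x ∈ observableModule past N t :=
      fun t => remoteModule_le_observableModule past N t hx
    have h1 : x ∈ remoteModule past Φ := by
      refine (Submodule.mem_iInf _).2 fun t => ?_
      refine closedModule_le (S := N '' past t) ?_ (isActInvariant_closedModule _)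
        (isClosed_closedModule _) (hxt t)
      rintro _ ⟨l, hl, rfl⟩
      -- The correction `D l` is in the remote past module, hence observable at every moment `t`,
      -- whatever `l` is.
      rw [hN]
      exact sub_mem (subset_closedModule _ (mem_image_of_mem _ hl))
        (remoteModule_le_observableModule past Φ t (hDmem l))
    have h2 : x ∈ (remoteModule past Φ)ᗮ := by
      refine closedModule_le (S := N '' past 0) ?_ hinv.orthogonal
        (Submodule.isClosed_orthogonal _) (hxt 0)
      rintro _ ⟨l, -, rfl⟩
      exact hNmem l
    exact inner_self_eq_zero.1 (Submodule.inner_right_of_mem_orthogonal h1 h2)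
  · refine closedModule_le (range_subset_iff.2 fun l => ?_) (isActInvariant_closedModule _)
      (isClosed_closedModule _)
    rw [hN]
    exact sub_mem (subset_closedModule _ (mem_range_self l))
      (remoteModule_le_modularDomain past Φ (hDmem l))

/-! ### Mappings with the same pasts -/

/-- The domains and the remote pasts of two stochastic mappings agree. -/
structure SameRemotePast {Λ' : Type*} (past : Time d → Set Λ) (Φ : Λ → SecondOrder P H)
    (past' : Time d → Set Λ') (Ψ : Λ' → SecondOrder P H) : Prop where
  modularDomain_eq : modularDomain Φ = modularDomain Ψ
  vectorDomain_eq : vectorDomain Φ = vectorDomain Ψ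
  remoteModule_eq : remoteModule past Φ = remoteModule past' Ψ
  remoteSpace_eq : remoteSpace past Φ = remoteSpace past' Ψ

namespace SameRemotePast

variable {Λ' Λ'' : Type*} {past : Time d → Set Λ} {Φ : Λ → SecondOrder P H}
  {past' : Time d → Set Λ'} {Ψ : Λ' → SecondOrder P H}
  {past'' : Time d → Set Λ''} {Θ : Λ'' → SecondOrder P H}

/-- Two stochastic mappings have the same domains and remote pasts, if each of them is subordinate
to the other one, up to a shift of the time. -/
theorem of_shift (τ σ : Time d → Time d)
    (h1 : range Φ ⊆ closedSpace (range Ψ)) (h2 : range Ψ ⊆ closedSpace (range Φ))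
    (h3 : ∀ t, Φ '' past (τ t) ⊆ closedSpace (Ψ '' past' t))
    (h4 : ∀ t, Ψ '' past' (σ t) ⊆ closedSpace (Φ '' past t)) :
    SameRemotePast past Φ past' Ψ where
  modularDomain_eq := le_antisymm (closedModule_le_closedModule h1) (closedModule_le_closedModule h2)
  vectorDomain_eq := le_antisymm (closedSpace_le_closedSpace h1) (closedSpace_le_closedSpace h2)
  -- As `t` runs through all moments, each observable module at `t` contains one of the other
  -- mapping, at a shifted moment, and so its remote past.
  remoteModule_eq := le_antisymm
    (le_iInf fun t => (iInf_le _ (τ t)).trans (closedModule_le_closedModule (h3 t)))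
    (le_iInf fun t => (iInf_le _ (σ t)).trans (closedModule_le_closedModule (h4 t)))
  remoteSpace_eq := le_antisymm
    (le_iInf fun t => (iInf_le _ (τ t)).trans (closedSpace_le_closedSpace (h3 t)))
    (le_iInf fun t => (iInf_le _ (σ t)).trans (closedSpace_le_closedSpace (h4 t)))

theorem trans (h : SameRemotePast past Φ past' Ψ) (h' : SameRemotePast past' Ψ past'' Θ) :
    SameRemotePast past Φ past'' Θ :=
  ⟨h.1.trans h'.1, h.2.trans h'.2, h.3.trans h'.3, h.4.trans h'.4⟩

theorem sameDeterminism (h : SameRemotePast past Φ past' Ψ) :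
    SameDeterminism past Φ past' Ψ := by
  obtain ⟨h1, h2, h3, h4⟩ := h
  constructor
  · rw [IsOperatorDeterministic, IsOperatorDeterministic, h1, h3]
  · rw [IsOperatorNondeterministic, IsOperatorNondeterministic, h1, h3]
  · rw [IsOperatorPurelyNondeterministic, IsOperatorPurelyNondeterministic, h3]
  · rw [IsDeterministic, IsDeterministic, h2, h4]
  · rw [IsNondeterministic, IsNondeterministic, h2, h4]
  · rw [IsPurelyNondeterministic, IsPurelyNondeterministic, h4]

/-- This is what lets the Wold summands correspond: the same operator is applied on both sides. -/
theorem remoteProj_eq (h : SameRemotePast past Φ past' Ψ) :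
    remoteProj past Φ = remoteProj past' Ψ := by
  simp only [remoteProj, h.remoteModule_eq]

end SameRemotePast

end Modules

/-! ### Integrals against measures of finite semivariation: operators, estimates, approximation -/

section Integrals

variable {d : ℕ} {X : Type*} [NormedAddCommGroup X] [NormedSpace ℂ X]

namespace VecMeasure

theorem toFun_injective : Function.Injective (VecMeasure.toFun : VecMeasure d X → _) := by
  rintro ⟨ξ, _, _, _⟩ ⟨η, _, _, _⟩ h
  cases h
  rfl

variable (ξ : VecMeasure d X)

theorem ext_map (T : X →L[ℂ] X) (A : Set (Time d)) : (ξ.map T).ext A = T (ξ.ext A) := by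
  unfold ext
  split_ifs with h
  · rfl
  · exact (map_zero T).symm

theorem simpleIntegral_map (T : X →L[ℂ] X) (s : SimpleFunc (Time d) ℂ) :
    (ξ.map T).simpleIntegral s = T (ξ.simpleIntegral s) := by
  simp only [simpleIntegral, map_sum, map_smul, ext_map]

theorem HasIntegral.map {φ : Time d → ℂ} {y : X} (h : ξ.HasIntegral φ y) (T : X →L[ℂ] X) :
    (ξ.map T).HasIntegral φ (T y) := by
  obtain ⟨B, s, hs, hu, hl⟩ := h
  refine ⟨B, s, hs, hu, ?_⟩
  simp only [simpleIntegral_map]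
  exact (T.continuous.tendsto y).comp hl

theorem hasIntegral_simpleFunc (B : BoundedBorel d) (s : SimpleFunc (Time d) ℂ)
    (hs : ∀ x ∉ (B : Set (Time d)), s x = 0) : ξ.HasIntegral s (ξ.simpleIntegral s) :=
  ⟨B, fun _ => s, fun _ => hs,
    Metric.tendstoUniformly_iff.2 fun ε hε => Eventually.of_forall fun _ x => by simpa using hε,
    tendsto_const_nhds⟩

/-- It allows `ξ A` to be compared with `∫ φ dξ` by estimating the integral of a difference. -/
theorem hasIntegral_indicator (A : BoundedBorel d) :
    ξ.HasIntegral ((A : Set (Time d)).indicator 1) (ξ A) := by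
  let s : SimpleFunc (Time d) ℂ :=
    SimpleFunc.piecewise A A.2.1 (SimpleFunc.const _ 1) (SimpleFunc.const _ 0)
  have hs : (s : Time d → ℂ) = (A : Set (Time d)).indicator 1 := by
    classical
    ext x
    simp [s, SimpleFunc.coe_piecewise, piecewise, indicator]
  have hs0 : ∀ x ∉ (A : Set (Time d)), s x = 0 := fun x hx => by
    rw [hs, indicator_of_notMem hx]
  have h := ξ.hasIntegral_simpleFunc A s hs0
  have hempty : ξ.op A ∅ = 0 := by
    refine ContinuousLinearMap.ext fun z => ?_
    have := ξ.ext_coe ⟨∅, MeasurableSet.empty, Bornology.isBounded_empty⟩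
    simp only at this
    rw [op_apply, empty_inter, this, ξ.apply_empty _ rfl, smul_zero]
    rfl
  rwa [hs, ξ.simpleIntegral_eq A s hs0, SimpleFunc.setToSimpleFunc_indicator _ hempty A.2.1,
    op_apply, inter_self, ext_coe, one_smul] at h

theorem HasIntegral.sub {φ ψ : Time d → ℂ} {y z : X} (h : ξ.HasIntegral φ y)
    (h' : ξ.HasIntegral ψ z) : ξ.HasIntegral (φ - ψ) (y - z) := by
  have := HasIntegral.add ξ h (HasIntegral.smul ξ (-1) h')
  simpa [sub_eq_add_neg] using this

/-- The bound involves only a set carrying `φ`, although the approximating simple functions may live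
on a larger one: restricting them to `C` costs a uniformly small error. Continuity of `φ` is not
assumed, so that differences with indicators and simple functions are covered. -/
theorem norm_le_of_hasIntegral {φ : Time d → ℂ} {y : X} (h : ξ.HasIntegral φ y)
    (C : BoundedBorel d) (h0 : ∀ x ∉ (C : Set (Time d)), φ x = 0) {M : ℝ} (hM : ∀ x, ‖φ x‖ ≤ M) :
    ‖y‖ ≤ M * (semivariation ξ.toFun C).toReal := by
  obtain ⟨B, s, hs, hu, hl⟩ := h
  set V := (semivariation ξ.toFun C).toReal
  set W := (semivariation ξ.toFun (unionBB B C)).toReal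
  have hr : ∀ k x, (s k).restrict C x = (C : Set (Time d)).indicator (s k) x :=
    fun k x => SimpleFunc.restrict_apply _ C.2.1 x
  have key : ∀ ε > 0, ‖y‖ ≤ (M + ε) * V + ε * W := by
    intro ε hε
    refine le_of_tendsto hl.norm ?_
    filter_upwards [Metric.tendstoUniformly_iff.1 hu ε hε] with k hk
    have hk' : ∀ x, ‖s k x - φ x‖ ≤ ε := fun x => by
      rw [← dist_eq_norm, dist_comm]
      exact (hk x).le
    have h1 : ∀ x ∉ (unionBB B C : Set (Time d)), s k x = 0 :=
      fun x hx => hs k x fun h => hx (Or.inl h)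
    have h2 : ∀ x ∉ (C : Set (Time d)), (s k).restrict C x = 0 :=
      fun x hx => by rw [hr, indicator_of_notMem hx]
    have h3 : ∀ x ∉ (unionBB B C : Set (Time d)), (s k).restrict C x = 0 :=
      fun x hx => h2 x fun h => hx (Or.inr h)
    have h4 : ‖ξ.simpleIntegral ((s k).restrict C)‖ ≤ (M + ε) * V := by
      refine ξ.norm_simpleIntegral_le C _ h2 fun x => ?_
      have hMx : ‖s k x‖ ≤ M + ε := by
        calc ‖s k x‖ = ‖φ x + (s k x - φ x)‖ := by rw [add_sub_cancel]
          _ ≤ M + ε := (norm_add_le _ _).trans (add_le_add (hM x) (hk' x))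
      rw [hr]
      exact (norm_indicator_le_norm_self _ _).trans hMx
    -- Outside `C` the function `φ` vanishes, so there the simple function is itself at most `ε`.
    have h5 : ‖ξ.simpleIntegral (s k - (s k).restrict C)‖ ≤ ε * W := by
      refine ξ.norm_simpleIntegral_le _ _ (fun x hx => ?_) fun x => ?_
      · rw [SimpleFunc.coe_sub, Pi.sub_apply, h1 x hx, h3 x hx, sub_zero]
      · rw [SimpleFunc.coe_sub, Pi.sub_apply, hr]
        by_cases hx : x ∈ (C : Set (Time d))
        · rw [indicator_of_mem hx, sub_self, norm_zero]
          exact hε.le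
        · rw [indicator_of_notMem hx]
          simpa [h0 x hx] using hk' x
    rw [ξ.simpleIntegral_sub _ _ _ h1 h3] at h5
    calc ‖ξ.simpleIntegral (s k)‖
        = ‖ξ.simpleIntegral ((s k).restrict C) +
          (ξ.simpleIntegral (s k) - ξ.simpleIntegral ((s k).restrict C))‖ := by
          rw [add_sub_cancel]
      _ ≤ _ := (norm_add_le _ _).trans (add_le_add h4 h5)
  have hlim : Tendsto (fun ε : ℝ => (M + ε) * V + ε * W) (𝓝[>] 0) (𝓝 (M * V)) := by
    have : Continuous fun ε : ℝ => (M + ε) * V + ε * W := by fun_prop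
    simpa using (this.tendsto 0).mono_left nhdsWithin_le_nhds
  exact ge_of_tendsto hlim ((eventually_mem_nhdsWithin.mono key))

theorem simpleIntegral_mem (B : BoundedBorel d) (s : SimpleFunc (Time d) ℂ)
    (hs : ∀ x ∉ (B : Set (Time d)), s x = 0) :
    ξ.simpleIntegral s ∈ Submodule.span ℂ (ξ.toFun '' {A | (A : Set (Time d)) ⊆ B}) := by
  refine Submodule.sum_mem _ fun z _ => ?_
  -- The level set of `0` may be unbounded, but its coefficient vanishes; the other level sets lie
  -- in `B`.
  by_cases hz : z = 0
  · rw [hz, zero_smul]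
    exact Submodule.zero_mem _
  · have hsub : s ⁻¹' {z} ⊆ (B : Set (Time d)) := fun x hx => by
      by_contra h
      exact hz ((hs x h) ▸ hx.symm)
    let A : BoundedBorel d := ⟨s ⁻¹' {z}, s.measurableSet_fiber z, B.2.2.subset hsub⟩
    have : ξ.ext (s ⁻¹' {z}) = ξ A := ξ.ext_coe A
    rw [this]
    exact Submodule.smul_mem _ _ (Submodule.subset_span ⟨A, hsub, rfl⟩)

variable [CompleteSpace X]

/-- The support of a test function, as a bounded Borel set. -/
def _root_.WoldCoherence.testSupport {n : ℕ∞} (φ : Test d n) : BoundedBorel d :=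
  ⟨tsupport φ, (isClosed_tsupport _).measurableSet, φ.hasCompactSupport.isCompact.isBounded⟩

/-- The approximating simple functions are chosen to vanish outside the support of `φ`, so only
values of `ξ` on subsets of the support enter. This keeps the approximation within the past. -/
theorem integral_mem_closure_span {n : ℕ∞} (φ : Test d n) :
    ξ.integral φ ∈ (Submodule.span ℂ
      (ξ.toFun '' {A | (A : Set (Time d)) ⊆ tsupport φ})).topologicalClosure := by
  set B := testSupport φ
  set V := (semivariation ξ.toFun B).toReal
  have hV : 0 ≤ V := ENNReal.toReal_nonneg
  have h0 : ∀ x ∉ (B : Set (Time d)), φ x = 0 := fun x hx => image_eq_zero_of_notMem_tsupport hx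
  rw [← SetLike.mem_coe, Submodule.topologicalClosure_coe, Metric.mem_closure_iff]
  intro ε hε
  obtain ⟨s, hs, hsφ⟩ := exists_approx φ.continuous B φ.hasCompactSupport h0
    -- The denominator is `V + 1` because the semivariation `V` may be zero.
    (show 0 < ε / (V + 1) by positivity)
  refine ⟨ξ.simpleIntegral s, ξ.simpleIntegral_mem B s hs, ?_⟩
  have h := ξ.norm_le_of_hasIntegral
    (HasIntegral.sub ξ (ξ.hasIntegral_test φ) (ξ.hasIntegral_simpleFunc B s hs)) B
    (fun x hx => by simp [h0 x hx, hs x hx]) (M := ε / (V + 1))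
    (fun x => by
      rw [Pi.sub_apply, ← dist_eq_norm]
      exact (hsφ x).le)
  rw [dist_eq_norm]
  calc _ ≤ ε / (V + 1) * V := h
    _ < ε / (V + 1) * (V + 1) := by gcongr; linarith
    _ = ε := by field_simp

end VecMeasure

/-- Smooth test functions separating a compact set from the complement of an open neighbourhood. -/
theorem exists_test_eq_one (n : ℕ∞) {K O : Set (Time d)} (hK : IsCompact K) (hO : IsOpen O)
    (hKO : K ⊆ O) : ∃ φ : Test d n, ContDiff ℝ (⊤ : ℕ∞) φ ∧ tsupport φ ⊆ O ∧
      (∀ x ∈ K, φ x = 1) ∧ ∀ x, ∃ r ∈ Icc (0 : ℝ) 1, φ x = r := by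
  -- The function is made to vanish off the interior of `L`, so its closed support stays in the
  -- compact `L`, inside `O`.
  obtain ⟨L, hL, hKL, hLO⟩ := exists_compact_between hK hO hKO
  obtain ⟨f, hf, hfr, hf0, hf1⟩ := exists_contMDiff_zero_iff_one_iff_of_isClosed
    (n := ⊤) (modelWithCornersSelf ℝ (Time d))
    isOpen_interior.isClosed_compl hK.isClosed
    (disjoint_compl_left_iff_subset.2 hKL)
  have hf' : ContDiff ℝ (⊤ : ℕ∞) f := hf.contDiff
  have hφ : ContDiff ℝ (⊤ : ℕ∞) (fun x => (f x : ℂ)) := Complex.ofRealCLM.contDiff.comp hf'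
  have hsub : tsupport (fun x => (f x : ℂ)) ⊆ L := by
    refine closure_minimal (fun x hx => ?_) hL.isClosed
    by_contra h
    refine hx ?_
    simp only [Complex.ofReal_eq_zero]
    exact (hf0 x).1 fun h' => h (interior_subset h')
  have hcs : HasCompactSupport (fun x => (f x : ℂ)) :=
    hL.of_isClosed_subset (isClosed_tsupport _) hsub
  refine ⟨⟨fun x => (f x : ℂ), hφ.of_le (by exact_mod_cast le_top), hcs, fun _ _ => trivial⟩,
    hφ, hsub.trans hLO, fun x hx => ?_, fun x => ⟨f x, hfr (mem_range_self x), rfl⟩⟩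
  change ((f x : ℝ) : ℂ) = 1
  rw [(hf1 x).1 hx, Complex.ofReal_one]

variable [CompleteSpace X]

theorem measureDistribution_apply (n : ℕ∞) (ξ : VecMeasure d X) (φ : Test d n) :
    measureDistribution n ξ φ = ξ.integral φ := rfl

/-- The values of a regular measure on the subsets of an open set `V` are limits of integrals of
smooth test functions supported in `V`. -/
theorem VecMeasure.apply_mem_closure (n : ℕ∞) (ξ : VecMeasure d X) {A : BoundedBorel d}
    {V : Set (Time d)} (hV : IsOpen V) (hA : (A : Set (Time d)) ⊆ V) :
    ξ A ∈ closure (measureDistribution n ξ ''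
      {φ : Test d n | ContDiff ℝ (⊤ : ℕ∞) φ ∧ tsupport φ ⊆ V}) := by
  rw [Metric.mem_closure_iff]
  intro ε hε
  obtain ⟨K, O, hK, hO, hKA, hAO, hsv⟩ := ξ.regular A (ENNReal.ofReal ε) (by simpa using hε)
  -- Intersecting with `V` confines the support without spoiling the estimate on `O \ K`.
  obtain ⟨φ, hφ, hφO, hφ1, hφr⟩ := exists_test_eq_one n hK (hO.inter hV)
    (hKA.trans (subset_inter hAO hA))
  refine ⟨_, ⟨φ, ⟨hφ, hφO.trans inter_subset_right⟩, rfl⟩, ?_⟩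
  -- The indicator of `A` minus `φ` vanishes on `K` and outside `O` and is bounded by `1`, so its
  -- integral is at most the semivariation of `O \ K`.
  let C : BoundedBorel d := ⟨(O : Set (Time d)) \ K, O.2.1.diff K.2.1, O.2.2.subset sdiff_subset⟩
  have h := ξ.norm_le_of_hasIntegral
    (VecMeasure.HasIntegral.sub ξ (ξ.hasIntegral_indicator A) (ξ.hasIntegral_test φ)) C (M := 1)
    (fun x hx => by
      rw [Pi.sub_apply]
      by_cases hxK : x ∈ (K : Set (Time d))
      · rw [indicator_of_mem (hKA hxK), hφ1 x hxK, Pi.one_apply, sub_self]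
      · have hxO : x ∉ (O : Set (Time d)) := fun h => hx ⟨h, hxK⟩
        rw [indicator_of_notMem (fun h => hxO (hAO h)),
          image_eq_zero_of_notMem_tsupport (fun h => hxO (hφO h).1), sub_self])
    (fun x => by
      obtain ⟨r, ⟨hr0, hr1⟩, hr⟩ := hφr x
      rw [Pi.sub_apply, hr]
      by_cases hxA : x ∈ (A : Set (Time d))
      · rw [indicator_of_mem hxA, Pi.one_apply, ← Complex.ofReal_one, ← Complex.ofReal_sub,
          Complex.norm_real, Real.norm_of_nonneg (by linarith)]
        linarith
      · rw [indicator_of_notMem hxA, zero_sub, norm_neg, Complex.norm_real,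
          Real.norm_of_nonneg hr0]
        exact hr1)
  rw [dist_eq_norm, measureDistribution_apply]
  refine h.trans_lt ?_
  rw [one_mul]
  exact (ENNReal.lt_ofReal_iff_toReal_lt (ne_top_of_lt hsv)).1 hsv

theorem measureDistribution_map (n : ℕ∞) (ξ : VecMeasure d X) (T : X →L[ℂ] X) :
    measureDistribution n (ξ.map T) = T.comp (measureDistribution n ξ) :=
  ContinuousLinearMap.ext fun φ =>
    (ξ.map T).integral_eq (VecMeasure.HasIntegral.map ξ (ξ.hasIntegral_test φ) T)

/-! ### The measure of a continuous field -/

theorem fieldMeasure_map (F G : C(Time d, X)) (T : X →L[ℂ] X) (h : ∀ t, G t = T (F t)) :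
    (fieldMeasure F).map T = fieldMeasure G := by
  refine VecMeasure.toFun_injective (funext fun A => ?_)
  change T (∫ t in (A : Set (Time d)), F t) = ∫ t in (A : Set (Time d)), G t
  simp only [h]
  exact (T.integral_comp_comm (integrableOn_of_isBounded F A.2.2)).symm

/-- Averages of `F` stay in a closed convex set containing its values, and the integral is the
average times the volume. Null sets, which have no average, are treated apart. -/
theorem setIntegral_mem_closure_span (F : C(Time d, X)) (A : BoundedBorel d) :
    ∫ t in (A : Set (Time d)), F t ∈
      (Submodule.span ℂ (F '' (A : Set (Time d)))).topologicalClosure := by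
  set K := (Submodule.span ℂ (F '' (A : Set (Time d)))).topologicalClosure
  by_cases h0 : volume (A : Set (Time d)) = 0
  · rw [Measure.restrict_eq_zero.2 h0, integral_zero_measure]
    exact K.zero_mem
  · have hconv : Convex ℝ (K : Set X) := (K.restrictScalars ℝ).convex
    have h := hconv.set_average_mem (Submodule.isClosed_topologicalClosure _) h0
      A.2.2.measure_lt_top.ne
      ((ae_restrict_mem A.2.1).mono fun t ht => Submodule.le_topologicalClosure _
        (Submodule.subset_span (mem_image_of_mem F ht))) (integrableOn_of_isBounded F A.2.2)
    have h2 := (K.restrictScalars ℝ).smul_mem (volume.real (A : Set (Time d))) h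
    rwa [measure_smul_setAverage _ A.2.2.measure_lt_top.ne] at h2

/-- The averages are taken over cubes with upper corner `s`, which lie in the past of `s`; hence
fields and their measures can be compared without a shift of time. -/
theorem apply_mem_closure_span_fieldMeasure (F : C(Time d, X)) (s : Time d) :
    F s ∈ (Submodule.span ℂ
      ((fieldMeasure F).toFun '' {A | (A : Set (Time d)) ⊆ Iic s})).topologicalClosure := by
  rw [← SetLike.mem_coe, Submodule.topologicalClosure_coe, Metric.mem_closure_iff]
  intro ε hε
  obtain ⟨δ, hδ, hF⟩ := Metric.continuous_iff.1 F.continuous s (ε / 2) (half_pos hε)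
  -- The side is `δ / 2` because the continuity estimate needs distances strictly below `δ`.
  let A : BoundedBorel d := ⟨Icc (fun i => s i - δ / 2) s, measurableSet_Icc, isCompact_Icc.isBounded⟩
  have hA0 : volume (A : Set (Time d)) ≠ 0 := by
    have : volume (A : Set (Time d)) = ∏ i, ENNReal.ofReal (s i - (s i - δ / 2)) :=
      Real.volume_Icc_pi
    rw [this]
    refine Finset.prod_ne_zero_iff.2 fun i _ => ?_
    simpa using hδ
  have hAF : ∀ t ∈ (A : Set (Time d)), F t ∈ Metric.closedBall (F s) (ε / 2) := by
    intro t ht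
    refine (hF t ?_).le
    rw [dist_pi_lt_iff hδ]
    intro i
    have h1 := ht.1 i
    have h2 := ht.2 i
    simp only at h1
    rw [Real.dist_eq, abs_lt]
    constructor <;> linarith
  -- Closed balls are convex, so the average is as close to `F s` as the values are.
  have h := (convex_closedBall (F s) (ε / 2)).set_average_mem Metric.isClosed_closedBall hA0
    A.2.2.measure_lt_top.ne ((ae_restrict_mem A.2.1).mono hAF) (integrableOn_of_isBounded F A.2.2)
  refine ⟨⨍ t in (A : Set (Time d)), F t, ?_, ?_⟩
  · rw [setAverage_eq]
    refine ((Submodule.span ℂ _).restrictScalars ℝ).smul_mem _ (Submodule.subset_span ⟨A, ?_, rfl⟩)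
    exact fun t ht => ht.2
  · rw [dist_comm]
    exact lt_of_le_of_lt h (half_lt_self hε)

theorem fieldMeasure_simpleIntegral (F : C(Time d, X)) (B : BoundedBorel d)
    (s : SimpleFunc (Time d) ℂ) (hs : ∀ x ∉ (B : Set (Time d)), s x = 0) :
    (fieldMeasure F).simpleIntegral s = ∫ t, s t • F t := by
  have hcong : ∀ z, EqOn (fun t => s t • F t) (fun t => z • F t) (s ⁻¹' {z}) := fun z t ht => by
    simp only [show s t = z from ht]
  have hsub : ∀ z ≠ 0, s ⁻¹' {z} ⊆ (B : Set (Time d)) := fun z hz x hx => by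
    by_contra h
    exact hz ((hs x h) ▸ hx.symm)
  have huniv : ⋃ z ∈ s.range, s ⁻¹' {z} = univ := by
    ext x
    simp
  rw [← setIntegral_univ, ← huniv, integral_biUnion_finset _ (fun z _ => s.measurableSet_fiber z)]
  · refine Finset.sum_congr rfl fun z _ => ?_
    rw [setIntegral_congr_fun (s.measurableSet_fiber z) (hcong z), integral_smul]
    by_cases hz : z = 0
    · rw [hz, zero_smul, zero_smul]
    · congr 1
      exact (fieldMeasure F).ext_coe
        ⟨s ⁻¹' {z}, s.measurableSet_fiber z, B.2.2.subset (hsub z hz)⟩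
  · intro z _ w _ hzw
    exact Disjoint.preimage _ (disjoint_singleton.2 hzw)
  · intro z _
    refine IntegrableOn.congr_fun ?_ (hcong z).symm (s.measurableSet_fiber z)
    -- Integrability over the possibly unbounded level set of `0` holds because the integrand
    -- vanishes there.
    by_cases hz : z = 0
    · simp only [hz, zero_smul]
      exact integrableOn_zero
    · exact (integrableOn_of_isBounded F (B.2.2.subset (hsub z hz))).smul z

/-- Both sides agree on simple functions; uniform approximation on the support of `φ` and dominated
convergence give the rest. -/
theorem fieldMeasure_integral (F : C(Time d, X)) {n : ℕ∞} (φ : Test d n) :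
    (fieldMeasure F).integral φ = ∫ t, φ t • F t := by
  set B := testSupport φ with hB
  have h0 : ∀ x ∉ (B : Set (Time d)), φ x = 0 := fun x hx => image_eq_zero_of_notMem_tsupport hx
  choose s hs0 hs using fun k : ℕ => VecMeasure.exists_approx φ.continuous B φ.hasCompactSupport h0
    (Nat.one_div_pos_of_nat (α := ℝ) (n := k))
  refine (fieldMeasure F).integral_eq ⟨B, s, hs0, ?_, ?_⟩
  · rw [Metric.tendstoUniformly_iff]
    intro ε hε
    obtain ⟨N, hN⟩ := exists_nat_one_div_lt hε
    filter_upwards [eventually_ge_atTop N] with k hk x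
    exact (hs k x).trans (lt_of_le_of_lt (Nat.one_div_le_one_div hk) hN)
  · simp only [fun k => fieldMeasure_simpleIntegral F B (s k) (hs0 k)]
    obtain ⟨C, hC⟩ := φ.hasCompactSupport.exists_bound_of_continuous φ.continuous
    -- Here `C` bounds `φ`, and each `s k` is within `1 / (k + 1) ≤ 1` of `φ`; hence the factor `C +
    -- 1`.
    refine tendsto_integral_of_dominated_convergence
      (fun t => (B : Set (Time d)).indicator (fun t => (C + 1) * ‖F t‖) t) (fun k => ?_) ?_
      (fun k => ae_of_all _ fun t => ?_) (ae_of_all _ fun t => ?_)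
    · exact (s k).stronglyMeasurable.aestronglyMeasurable.smul F.continuous.aestronglyMeasurable
    · rw [integrable_indicator_iff B.2.1]
      exact (integrableOn_of_isBounded F B.2.2).norm.const_mul _
    · by_cases ht : t ∈ (B : Set (Time d))
      · rw [indicator_of_mem ht, norm_smul]
        gcongr
        have h1 := (hs k t).le
        rw [dist_comm, dist_eq_norm] at h1
        have h2 : 1 / ((k : ℝ) + 1) ≤ 1 := by
          rw [div_le_one (by positivity)]
          linarith [(Nat.cast_nonneg k : (0 : ℝ) ≤ k)]
        calc ‖s k t‖ = ‖φ t + (s k t - φ t)‖ := by rw [add_sub_cancel]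
          _ ≤ C + 1 := (norm_add_le _ _).trans (add_le_add (hC t) (h1.trans h2))
      · rw [indicator_of_notMem ht, hs0 k t ht, zero_smul, norm_zero]
    · refine Tendsto.smul_const ?_ _
      rw [tendsto_iff_dist_tendsto_zero]
      refine squeeze_zero (fun _ => dist_nonneg) (fun k => ?_)
        (tendsto_one_div_add_atTop_nhds_zero_nat (𝕜 := ℝ))
      rw [dist_comm]
      exact (hs k t).le

theorem fieldDistribution_eq (n : ℕ∞) (F : C(Time d, X)) :
    fieldDistribution n F = measureDistribution n (fieldMeasure F) :=
  ContinuousLinearMap.ext fun φ => by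
    rw [fieldDistribution_apply, measureDistribution_apply, fieldMeasure_integral]

end Integrals

section Coherence

variable {Ω : Type*} [MeasurableSpace Ω] {P : Measure Ω} [IsProbabilityMeasure P]
  {H : Type*} [NormedAddCommGroup H] [InnerProductSpace ℂ H] [CompleteSpace H] {d : ℕ}

/-! ### Coherence of the remote pasts and of the Wold summands -/

theorem sameRemotePast_measureDistribution (n : ℕ∞) (ξ : VecMeasure d (SecondOrder P H)) :
    SameRemotePast (measurePast d) ξ (testPast d n) (measureDistribution n ξ) := by
  -- Test functions approximating `ξ A` need room around `A`. If `A` lies below `t - 1`, the open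
  -- orthant strictly below `t` provides it; in the other direction no shift is needed.
  refine SameRemotePast.of_shift (fun t i => t i - 1) id ?_ ?_ (fun t => ?_) (fun t => ?_)
  · rintro _ ⟨A, rfl⟩
    refine closure_mono ?_ (ξ.apply_mem_closure n isOpen_univ (subset_univ (A : Set (Time d))))
    exact (image_subset_range _ _).trans Submodule.subset_span
  · rintro _ ⟨φ, rfl⟩
    exact Submodule.topologicalClosure_mono (Submodule.span_mono (image_subset_range _ _))
      (ξ.integral_mem_closure_span φ)
  · rintro _ ⟨A, hA, rfl⟩
    have hV : IsOpen (univ.pi fun i => Iio (t i)) :=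
      isOpen_set_pi finite_univ fun i _ => isOpen_Iio
    refine closure_mono ?_ (ξ.apply_mem_closure n hV
      (fun x hx i _ => (hA hx i).trans_lt (sub_one_lt (t i))))
    refine Subset.trans (image_mono ?_) Submodule.subset_span
    exact fun φ hφ => ⟨hφ.1, fun x hx i => (hφ.2 hx i (mem_univ i)).le⟩
  · rintro _ ⟨φ, hφ, rfl⟩
    refine Submodule.topologicalClosure_mono (Submodule.span_mono (image_mono ?_))
      (ξ.integral_mem_closure_span φ)
    exact fun A hA => Subset.trans hA hφ.2

theorem sameRemotePast_fieldMeasure (F : C(Time d, SecondOrder P H)) :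
    SameRemotePast (fieldPast d) F (measurePast d) (fieldMeasure F) := by
  refine SameRemotePast.of_shift id id ?_ ?_ (fun t => ?_) (fun t => ?_)
  · rintro _ ⟨s, rfl⟩
    exact Submodule.topologicalClosure_mono (Submodule.span_mono (image_subset_range _ _))
      (apply_mem_closure_span_fieldMeasure F s)
  · rintro _ ⟨A, rfl⟩
    exact Submodule.topologicalClosure_mono (Submodule.span_mono (image_subset_range _ _))
      (setIntegral_mem_closure_span F A)
  · rintro _ ⟨s, hs, rfl⟩
    refine Submodule.topologicalClosure_mono (Submodule.span_mono (image_mono ?_))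
      (apply_mem_closure_span_fieldMeasure F s)
    exact fun A hA => Subset.trans hA (Iic_subset_Iic.2 hs)
  · rintro _ ⟨A, hA, rfl⟩
    exact Submodule.topologicalClosure_mono (Submodule.span_mono (image_mono hA))
      (setIntegral_mem_closure_span F A)

theorem isWoldDecomposition_field (F : C(Time d, SecondOrder P H)) :
    IsWoldDecomposition (fieldPast d) F (fieldDet F) (fieldPnd F) :=
  isWoldDecomposition_remoteProj _ (fun _ => rfl) (fun _ => rfl)

theorem isWoldDecomposition_measure (ξ : VecMeasure d (SecondOrder P H)) :
    IsWoldDecomposition (measurePast d) ξ (measureDet ξ) (measurePnd ξ) :=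
  isWoldDecomposition_remoteProj _ (fun _ => rfl) (fun _ => rfl)

theorem isWoldDecomposition_distribution {n : ℕ∞} (U : Test d n →L[ℂ] SecondOrder P H) :
    IsWoldDecomposition (testPast d n) U (distributionDet U) (distributionPnd U) :=
  isWoldDecomposition_remoteProj _ (fun _ => rfl) (fun _ => rfl)

/-- Once the two projections are identified, only the commutation of a bounded operator with the
integral is left. -/
theorem measureDet_fieldMeasure (F : C(Time d, SecondOrder P H)) :
    measureDet (fieldMeasure F) = fieldMeasure (fieldDet F) := by
  rw [measureDet, ← (sameRemotePast_fieldMeasure F).remoteProj_eq]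
  exact fieldMeasure_map F _ _ fun _ => rfl

theorem measurePnd_fieldMeasure (F : C(Time d, SecondOrder P H)) :
    measurePnd (fieldMeasure F) = fieldMeasure (fieldPnd F) := by
  rw [measurePnd, ← (sameRemotePast_fieldMeasure F).remoteProj_eq]
  exact fieldMeasure_map F _ _ fun _ => rfl

theorem distributionDet_measureDistribution (n : ℕ∞) (ξ : VecMeasure d (SecondOrder P H)) :
    distributionDet (measureDistribution n ξ) = measureDistribution n (measureDet ξ) := by
  rw [distributionDet, measureDet, measureDistribution_map,
    (sameRemotePast_measureDistribution n ξ).remoteProj_eq]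

theorem distributionPnd_measureDistribution (n : ℕ∞) (ξ : VecMeasure d (SecondOrder P H)) :
    distributionPnd (measureDistribution n ξ) = measureDistribution n (measurePnd ξ) := by
  rw [distributionPnd, measurePnd, measureDistribution_map,
    (sameRemotePast_measureDistribution n ξ).remoteProj_eq]

end Coherence

end WoldCoherence

/-! ### The corollary -/

open WoldCoherence

theorem corollary5p5 {Ω : Type*} [MeasurableSpace Ω] (P : Measure Ω) [IsProbabilityMeasure P]
    (H : Type*) [NormedAddCommGroup H] [InnerProductSpace ℂ H] [CompleteSpace H]
    (d : ℕ) (n : ℕ∞) :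
    -- continuous random fields `F`, with their measure `ξ^F` and their distribution `U^F`
    (∀ F : C(Time d, SecondOrder P H),
      SameDeterminism (fieldPast d) F (measurePast d) (fieldMeasure F) ∧
      SameDeterminism (fieldPast d) F (testPast d n) (fieldDistribution n F) ∧
      IsWoldDecomposition (fieldPast d) F (fieldDet F) (fieldPnd F) ∧
      IsWoldDecomposition (measurePast d) (fieldMeasure F)
        (measureDet (fieldMeasure F)) (measurePnd (fieldMeasure F)) ∧
      IsWoldDecomposition (testPast d n) (fieldDistribution n F)
        (distributionDet (fieldDistribution n F)) (distributionPnd (fieldDistribution n F)) ∧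
      measureDet (fieldMeasure F) = fieldMeasure (fieldDet F) ∧
      measurePnd (fieldMeasure F) = fieldMeasure (fieldPnd F) ∧
      distributionDet (fieldDistribution n F) = fieldDistribution n (fieldDet F) ∧
      distributionPnd (fieldDistribution n F) = fieldDistribution n (fieldPnd F)) ∧
    -- regular measures `ξ` of finite semivariation, with their distribution `U^ξ`
    (∀ ξ : VecMeasure d (SecondOrder P H),
      SameDeterminism (measurePast d) ξ (testPast d n) (measureDistribution n ξ) ∧
      IsWoldDecomposition (measurePast d) ξ (measureDet ξ) (measurePnd ξ) ∧
      IsWoldDecomposition (testPast d n) (measureDistribution n ξ)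
        (distributionDet (measureDistribution n ξ)) (distributionPnd (measureDistribution n ξ)) ∧
      distributionDet (measureDistribution n ξ) = measureDistribution n (measureDet ξ) ∧
      distributionPnd (measureDistribution n ξ) = measureDistribution n (measurePnd ξ)) := by
  refine ⟨fun F => ?_, fun ξ => ?_⟩
  · have hFξ := sameRemotePast_fieldMeasure F
    refine ⟨hFξ.sameDeterminism, ?_, isWoldDecomposition_field F, isWoldDecomposition_measure _,
      isWoldDecomposition_distribution _, measureDet_fieldMeasure F, measurePnd_fieldMeasure F,
      ?_, ?_⟩
    -- The comparison of `F` with `U^F` passes through `ξ^F`.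
    · rw [fieldDistribution_eq]
      exact (hFξ.trans (sameRemotePast_measureDistribution n _)).sameDeterminism
    · rw [fieldDistribution_eq, fieldDistribution_eq, distributionDet_measureDistribution,
        measureDet_fieldMeasure]
    · rw [fieldDistribution_eq, fieldDistribution_eq, distributionPnd_measureDistribution,
        measurePnd_fieldMeasure]
  · exact ⟨(sameRemotePast_measureDistribution n ξ).sameDeterminism,
      isWoldDecomposition_measure ξ, isWoldDecomposition_distribution _,
      distributionDet_measureDistribution n ξ, distributionPnd_measureDistribution n ξ⟩
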